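/- **Definitions.** An *arrow presentation* $G$ is a finite set of circles with finitely many disjoint arrows lying on them, each labelled by an *edge*, every edge labelling exactly two arrows. The circles are the *vertices*; $V(G)$ and $E(G)$ are the sets of vertices and edges. The *boundary components* are the closed curves obtained by removing all arrows with the arcs they lie on and, for each edge with arrows $\overrightarrow{p_1p_2}$, $\overrightarrow{q_1q_2}$, joining $p_1$ to $q_2$ and $p_2$ to $q_1$. A *packaged arrow presentation* $\mathbb G=(G,\mathcal V,\mathcal B)$ is an arrow presentation with a partition $\mathcal V$ of its vertices and a partition $\mathcal B$ of its boundary components. Let $e$ be an edge with arrows $\overrightarrow{p_1p_2}$ and $\overrightarrow{q_1q_2}$. *Deletion* of $e$ forgets the two arrows and keeps the arcs they lie on; *contraction* removes both arrows with their arcs and identifies $p_1$ with $q_2$ and $p_2$ with $q_1$; *Penrose-contraction* removes them and identifies $p_1$ with $q_1$ and $p_2$ with $q_2$. Newly created vertices (boundary components) belong to the union of the classes of the vertices (boundary components) incident with $e$. For packaged arrow presentations: $\mathbb G\setminus e$ is the deletion, where the boundary classes of the boundary components incident with $e$ are merged and the vertex partition is unchanged; the merge-deletion $\mathbb G\setminus_{m}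 e$ is the deletion where in addition the classes of the two ends of $e$ are merged; $\mathbb G/e$ is the contraction, where the vertex classes of the ends of $e$ are merged and the boundary partition is unchanged; the merge-contraction $\mathbb G/_{m}e$ is the contraction where in addition the boundary classes at $e$ are merged; and $\mathbb G/_{\times}e$ is the Penrose-contraction, where both the vertex classes and the boundary classes at $e$ are merged. A *coupling* $\varphi$ of an edge $f$ of $\mathbb G$ and an edge $e$ of $\mathbb H$ is a bijection from the two arrows of $f$ to the two arrows of $e$. If $\varphi$ sends $\overrightarrow{p_1p_2}$ to $\overrightarrow{q_1q_2}$ and $\overrightarrow{p_3p_4}$ to $\overrightarrow{q_3q_4}$, the *2-sum* $\mathbb G\oplus_\varphi\mathbb H$ arises from the disjoint union by removing these four arrows with their arcs and identifying $p_i$ with $q_i$ for $i=1,\dots,4$; the class of the vertex through $\overrightarrow{p_1p_2}$ is united with that of the vertex through $\overrightarrow{q_1q_2}$, likewise for $\overrightarrow{p_3p_4}$ and $\overrightarrow{q_3q_4}$; the class of the boundary component through $p_1,p_4$ is united with that of the one through $q_1,q_4$, and likewise for $p_2,p_3$ and $q_2,q_3$. (Vertices and boundary components of the 2-sum through $p_i=q_i$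 belong to the corresponding united classes.) Given an edge $e$ of $\mathbb H$ and a family $\boldsymbol\varphi=\{\varphi_f\}_{f\in E(\mathbb G)}$ of couplings $\varphi_f$ of $f$ and $e$, the *tensor product* $\mathbb G\otimes_{\boldsymbol\varphi}\mathbb H$ is obtained from $\mathbb G$ by taking successively, for each edge $f$ of $\mathbb G$ (in any order), the 2-sum with a separate copy of $\mathbb H$ with respect to $\varphi_f$. **Statement.** There is a unique map $Z(\,\cdot\,;a,b,\alpha,\beta,\gamma)$ from packaged arrow presentations to $\mathbb Z[a,b,\alpha,\beta,\gamma]$ such that $$Z(\mathbb G)=a\,Z(\mathbb G\setminus e)+b\,Z(\mathbb G/e)\ \text{ for every edge } e,\qquad Z(\mathbb G)=\alpha^{|V(G)|}\beta^{|\mathcal V|}\gamma^{|\mathcal B|}\ \text{ if } G \text{ is edgeless},$$ and a unique map $Q(\,\cdot\,;a,b,c,x,y,\alpha,\beta,\gamma)$ to $\mathbb Z[a,b,c,x,y,\alpha,\beta,\gamma]$ such that $$Q(\mathbb G)=a\,Q(\mathbb G\setminus e)+b\,Q(\mathbb G/e)+c\,Q(\mathbb G/_{\times}e)+x\,Q(\mathbb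 G\setminus_{m}e)+y\,Q(\mathbb G/_{m}e)\ \text{ for every edge } e,$$ with the same values on edgeless packaged arrow presentations. Let $\mathbb G$ and $\mathbb H$ be packaged arrow presentations, let $e$ be a fixed edge of $\mathbb H$, for each edge $f$ of $\mathbb G$ let $\varphi_f$ be a coupling of $f$ and $e$, and let $\boldsymbol\varphi=\{\varphi_f\}_{f\in E(\mathbb G)}$. Then $$Z(\mathbb G\otimes_{\boldsymbol\varphi}\mathbb H;a,b,\alpha,\beta,\gamma)=Q(\mathbb G;\phi_{(=,2)},\phi_{(\parallel,2)},\phi_\times,\phi_{(=,1)},\phi_{(\parallel,1)},\alpha,\beta,\gamma),$$ where the $\phi$'s are given by the unique solution, over the field of fractions of $\mathbb Z[a,b,\alpha,\beta,\gamma]$, of $$\alpha\beta\gamma\begin{bmatrix}\alpha\beta&1&1&\alpha&1\\1&\alpha\gamma&1&1&\alpha\\1&1&\alpha&1&1\\\alpha&1&1&\alpha&1\\1&\alpha&1&1&\alpha\end{bmatrix}\begin{bmatrix}\phi_{(=,2)}\\\phi_{(\parallel,2)}\\\phi_\times\\\phi_{(=,1)}\\\phi_{(\parallel,1)}\end{bmatrix}=\begin{bmatrix}Z(\mathbb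 H\setminus e;a,b,\alpha,\beta,\gamma)\\Z(\mathbb H/e;a,b,\alpha,\beta,\gamma)\\Z(\mathbb H/_{\times}e;a,b,\alpha,\beta,\gamma)\\Z(\mathbb H\setminus_{m}e;a,b,\alpha,\beta,\gamma)\\Z(\mathbb H/_{m}e;a,b,\alpha,\beta,\gamma)\end{bmatrix}.$$ -/

import Mathlib

universe u

/-! ### Arrow presentations -/

/-- A (finite) arrow presentation, in combinatorial form. The circles are cut by a finite set `Pt` of
points into arcs that are alternately *outer* and *inner* arcs; each point `p` is joined to
`outer p` by an outer arc and to `inner p` by an inner arc. Every arrow lies along an inner arc,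
and every edge `e` has two arrows, indexed by `Bool`: the arrow `i` of `e` is directed from the
point `arrow (e, i, false)` (its tail) to the point `arrow (e, i, true)` (its head).
Inner arcs that carry no arrow are allowed, so a circle without arrows is, for instance, one with
two points. -/
structure ArrowPresentation : Type (u + 1) where
  /-- the marked points on the circles -/
  Pt : Type u
  /-- the edge set -/
  Edge : Type u
  finite_pt : Finite Pt
  finite_edge : Finite Edge
  outer : Pt → Pt
  outer_outer : ∀ p, outer (outer p) = p
  outer_ne : ∀ p, outer p ≠ p
  inner : Pt → Pt
  inner_inner : ∀ p, inner (inner p) = p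
  inner_ne : ∀ p, inner p ≠ p
  /-- tails (`false`) and heads (`true`) of the two arrows of each edge -/
  arrow : Edge × Bool × Bool → Pt
  arrow_injective : Function.Injective arrow
  inner_arrow : ∀ e i b, inner (arrow (e, i, b)) = arrow (e, i, !b)

namespace ArrowPresentation

/-- Two points are equivalent iff they lie on the same circle. -/
def vertexSetoid (G : ArrowPresentation.{u}) : Setoid G.Pt :=
  Relation.EqvGen.setoid fun p q => q = G.outer p ∨ q = G.inner p

/-- The vertices (circles) of an arrow presentation. -/
def Vertex (G : ArrowPresentation.{u}) : Type u := Quotient G.vertexSetoid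

/-- The boundary components are the closed curves obtained by deleting all arrows with the arcs that
they lie on and, for every edge, joining the tail of each of its two arrows to the head of the
other one. Two points are equivalent iff they lie on the same such curve. -/
def boundarySetoid (G : ArrowPresentation.{u}) : Setoid G.Pt :=
  Relation.EqvGen.setoid fun p q =>
    q = G.outer p ∨ (p ∉ Set.range G.arrow ∧ q = G.inner p) ∨
      ∃ e i b, p = G.arrow (e, i, b) ∧ q = G.arrow (e, !i, !b)

/-- The boundary components of an arrow presentation. -/
def BoundaryComponent (G : ArrowPresentation.{u}) : Type u := Quotient G.boundarySetoid

open Classical in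
/-- The inner arcs after the two arrow arcs of `e` have been removed and the four ends of the arrows
of `e` have been joined according to `m`. -/
noncomputable def rewire (G : ArrowPresentation.{u}) (e : G.Edge) (m : Bool × Bool → Bool × Bool)
    (p : G.Pt) : G.Pt :=
  if h : ∃ t, G.arrow (e, t) = p then G.arrow (e, m h.choose) else G.inner p

theorem rewire_arrow (G : ArrowPresentation.{u}) (e : G.Edge) (m : Bool × Bool → Bool × Bool)
    (t : Bool × Bool) : G.rewire e m (G.arrow (e, t)) = G.arrow (e, m t) := by
  have h : ∃ s, G.arrow (e, s) = G.arrow (e, t) := ⟨t, rfl⟩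
  have h2 : h.choose = t := by
    have := G.arrow_injective h.choose_spec
    simpa using this
  unfold rewire
  rw [dif_pos h, h2]

theorem rewire_of_not (G : ArrowPresentation.{u}) (e : G.Edge) (m : Bool × Bool → Bool × Bool)
    (p : G.Pt) (h : ¬ ∃ t, G.arrow (e, t) = p) : G.rewire e m p = G.inner p := by
  unfold rewire
  rw [dif_neg h]

theorem inner_not (G : ArrowPresentation.{u}) (e : G.Edge) (p : G.Pt)
    (h : ¬ ∃ t, G.arrow (e, t) = p) : ¬ ∃ t, G.arrow (e, t) = G.inner p := by
  rintro ⟨⟨i, b⟩, ht⟩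
  refine h ⟨(i, !b), ?_⟩
  rw [← G.inner_arrow, ht, G.inner_inner]

/-- Remove the edge `e`, joining the four ends of its arrows according to the fixed point free
involution `m`. -/
noncomputable def resolve (G : ArrowPresentation.{u}) (e : G.Edge) (m : Bool × Bool → Bool × Bool)
    (hm : ∀ t, m (m t) = t) (hm' : ∀ t, m t ≠ t) : ArrowPresentation.{u} where
  Pt := G.Pt
  Edge := {g : G.Edge // g ≠ e}
  finite_pt := G.finite_pt
  finite_edge := by
    have := G.finite_edge
    infer_instance
  outer := G.outer
  outer_outer := G.outer_outer
  outer_ne := G.outer_ne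
  inner := G.rewire e m
  inner_inner := by
    intro p
    by_cases h : ∃ t, G.arrow (e, t) = p
    · obtain ⟨t, rfl⟩ := h
      rw [rewire_arrow, rewire_arrow, hm]
    · rw [rewire_of_not _ _ _ _ h, rewire_of_not _ _ _ _ (G.inner_not e p h), G.inner_inner]
  inner_ne := by
    intro p
    by_cases h : ∃ t, G.arrow (e, t) = p
    · obtain ⟨t, rfl⟩ := h
      rw [rewire_arrow]
      intro h
      have := G.arrow_injective h
      simp only [Prod.mk.injEq, true_and] at this
      exact hm' t this
    · rw [rewire_of_not _ _ _ _ h]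
      exact G.inner_ne p
  arrow := fun t => G.arrow (t.1.1, t.2)
  arrow_injective := by
    rintro ⟨⟨g, hg⟩, s⟩ ⟨⟨g', hg'⟩, s'⟩ h
    have := G.arrow_injective h
    simp only [Prod.mk.injEq] at this
    obtain ⟨rfl, rfl⟩ := this
    rfl
  inner_arrow := by
    rintro ⟨g, hg⟩ i b
    have h : ¬ ∃ t, G.arrow (e, t) = G.arrow (g, i, b) := by
      rintro ⟨t, ht⟩
      have := G.arrow_injective ht
      simp only [Prod.mk.injEq] at this
      exact hg this.1.symm
    rw [rewire_of_not _ _ _ _ h, G.inner_arrow]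

/-- Deletion: the arrows of `e` are removed, the arcs they lie on are kept. -/
noncomputable def delete (G : ArrowPresentation.{u}) (e : G.Edge) : ArrowPresentation.{u} :=
  G.resolve e (fun t => (t.1, !t.2)) (by decide) (by decide)

/-- Contraction: the tail of each arrow of `e` is joined to the head of the other one. -/
noncomputable def contract (G : ArrowPresentation.{u}) (e : G.Edge) : ArrowPresentation.{u} :=
  G.resolve e (fun t => (!t.1, !t.2)) (by decide) (by decide)

/-- Penrose-contraction: the two tails are joined, and the two heads are joined. -/
noncomputable def penrose (G : ArrowPresentation.{u}) (e : G.Edge) : ArrowPresentation.{u} :=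
  G.resolve e (fun t => (!t.1, t.2)) (by decide) (by decide)

theorem vertexSetoid_resolve_le (G : ArrowPresentation.{u}) (e : G.Edge)
    (m : Bool × Bool → Bool × Bool) (hm : ∀ t, m (m t) = t) (hm' : ∀ t, m t ≠ t)
    (S : Setoid G.Pt) (hS : G.vertexSetoid ≤ S)
    (h : ∀ t, S (G.arrow (e, t)) (G.arrow (e, m t))) :
    (G.resolve e m hm hm').vertexSetoid ≤ S := by
  refine Setoid.eqvGen_le (r := fun p q : G.Pt => q = G.outer p ∨ q = G.rewire e m p) ?_
  rintro p q (rfl | rfl)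
  · exact hS (Relation.EqvGen.rel _ _ (Or.inl rfl))
  · by_cases hp : ∃ t, G.arrow (e, t) = p
    · obtain ⟨t, rfl⟩ := hp
      rw [rewire_arrow]
      exact h t
    · rw [rewire_of_not _ _ _ _ hp]
      exact hS (Relation.EqvGen.rel _ _ (Or.inr rfl))

theorem boundarySetoid_resolve_le (G : ArrowPresentation.{u}) (e : G.Edge)
    (m : Bool × Bool → Bool × Bool) (hm : ∀ t, m (m t) = t) (hm' : ∀ t, m t ≠ t)
    (S : Setoid G.Pt) (hS : G.boundarySetoid ≤ S)
    (h : ∀ t, S (G.arrow (e, t)) (G.arrow (e, m t))) :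
    (G.resolve e m hm hm').boundarySetoid ≤ S := by
  refine Setoid.eqvGen_le (r := fun p q : G.Pt => q = G.outer p ∨
    (p ∉ Set.range (G.resolve e m hm hm').arrow ∧ q = G.rewire e m p) ∨
      ∃ (g : {g : G.Edge // g ≠ e}) (i b : Bool),
        p = G.arrow (g.1, i, b) ∧ q = G.arrow (g.1, !i, !b)) ?_
  rintro p q (rfl | ⟨hp, rfl⟩ | ⟨g, i, b, rfl, rfl⟩)
  · exact hS (Relation.EqvGen.rel _ _ (Or.inl rfl))
  · by_cases hp' : ∃ t, G.arrow (e, t) = p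
    · obtain ⟨t, rfl⟩ := hp'
      rw [rewire_arrow]
      exact h t
    · rw [rewire_of_not _ _ _ _ hp']
      refine hS (Relation.EqvGen.rel _ _ (Or.inr (Or.inl ⟨?_, rfl⟩)))
      rintro ⟨⟨g, t⟩, rfl⟩
      by_cases hg : g = e
      · subst hg
        exact hp' ⟨t, rfl⟩
      · exact hp ⟨(⟨g, hg⟩, t), rfl⟩
  · exact hS (Relation.EqvGen.rel _ _ (Or.inr (Or.inr ⟨g.1, i, b, rfl, rfl⟩)))

/-! ### 2-sums of arrow presentations -/

/-- A coupling of two edges: a bijection from the pair of arrows of the first edge to the pair of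
arrows of the second one. -/
abbrev Coupling : Type := Bool ≃ Bool

open Classical in
/-- One half of the inner arcs of a 2-sum: at the ends of the arrows of `f` one is led to the
corresponding ends of the arrows of `e`; elsewhere nothing changes. -/
noncomputable def crossing (G H : ArrowPresentation.{u}) (f : G.Edge) (e : H.Edge) (φ : Coupling)
    (p : G.Pt) : G.Pt ⊕ H.Pt :=
  if h : ∃ t, G.arrow (f, t) = p then Sum.inr (H.arrow (e, φ h.choose.1, h.choose.2))
  else Sum.inl (G.inner p)

theorem crossing_arrow (G H : ArrowPresentation.{u}) (f : G.Edge) (e : H.Edge) (φ : Coupling)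
    (i b : Bool) : G.crossing H f e φ (G.arrow (f, i, b)) = Sum.inr (H.arrow (e, φ i, b)) := by
  have h : ∃ s, G.arrow (f, s) = G.arrow (f, i, b) := ⟨(i, b), rfl⟩
  have h2 : h.choose = (i, b) := by
    have := G.arrow_injective h.choose_spec
    simpa using this
  unfold crossing
  rw [dif_pos h, h2]

theorem crossing_of_not (G H : ArrowPresentation.{u}) (f : G.Edge) (e : H.Edge) (φ : Coupling)
    (p : G.Pt) (h : ¬ ∃ t, G.arrow (f, t) = p) :
    G.crossing H f e φ p = Sum.inl (G.inner p) := by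
  unfold crossing
  rw [dif_neg h]

/-- The 2-sum: the arrows of `f` and of `e` are removed together with the arcs they lie on, and the
tail and the head of each arrow of `f` are joined to the tail and the head of the arrow of `e`
which `φ` assigns to it. -/
noncomputable def twoSum (G H : ArrowPresentation.{u}) (f : G.Edge) (e : H.Edge) (φ : Coupling) :
    ArrowPresentation.{u} where
  Pt := G.Pt ⊕ H.Pt
  Edge := {g : G.Edge // g ≠ f} ⊕ {h : H.Edge // h ≠ e}
  finite_pt := by
    have := G.finite_pt
    have := H.finite_pt
    infer_instance
  finite_edge := by
    have := G.finite_edge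
    have := H.finite_edge
    infer_instance
  outer := Sum.map G.outer H.outer
  outer_outer := by
    rintro (p | p)
    · simp [G.outer_outer]
    · simp [H.outer_outer]
  outer_ne := by
    rintro (p | p)
    · simpa using G.outer_ne p
    · simpa using H.outer_ne p
  inner := Sum.elim (G.crossing H f e φ) (fun q => (H.crossing G e f φ.symm q).swap)
  inner_inner := by
    rintro (p | p)
    · by_cases h : ∃ t, G.arrow (f, t) = p
      · obtain ⟨⟨i, b⟩, rfl⟩ := h
        simp [crossing_arrow]
      · simp [crossing_of_not _ _ _ _ _ _ h, crossing_of_not _ _ _ _ _ _ (G.inner_not f p h),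
          G.inner_inner]
    · by_cases h : ∃ t, H.arrow (e, t) = p
      · obtain ⟨⟨i, b⟩, rfl⟩ := h
        simp [crossing_arrow]
      · simp [crossing_of_not _ _ _ _ _ _ h, crossing_of_not _ _ _ _ _ _ (H.inner_not e p h),
          H.inner_inner]
  inner_ne := by
    rintro (p | p)
    · by_cases h : ∃ t, G.arrow (f, t) = p
      · obtain ⟨⟨i, b⟩, rfl⟩ := h
        simp [crossing_arrow]
      · simpa [crossing_of_not _ _ _ _ _ _ h] using G.inner_ne p
    · by_cases h : ∃ t, H.arrow (e, t) = p
      · obtain ⟨⟨i, b⟩, rfl⟩ := h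
        simp [crossing_arrow]
      · simpa [crossing_of_not _ _ _ _ _ _ h] using H.inner_ne p
  arrow := fun t => Sum.elim (fun g => Sum.inl (G.arrow (g.1, t.2)))
    (fun h => Sum.inr (H.arrow (h.1, t.2))) t.1
  arrow_injective := by
    rintro ⟨⟨g, hg⟩ | ⟨g, hg⟩, s⟩ ⟨⟨g', hg'⟩ | ⟨g', hg'⟩, s'⟩ h
    · have := G.arrow_injective (Sum.inl_injective h)
      simp only [Prod.mk.injEq] at this
      obtain ⟨rfl, rfl⟩ := this
      rfl
    · simp at h
    · simp at h
    · have := H.arrow_injective (Sum.inr_injective h)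
      simp only [Prod.mk.injEq] at this
      obtain ⟨rfl, rfl⟩ := this
      rfl
  inner_arrow := by
    rintro (⟨g, hg⟩ | ⟨g, hg⟩) i b
    · have h : ¬ ∃ t, G.arrow (f, t) = G.arrow (g, i, b) := by
        rintro ⟨t, ht⟩
        have := G.arrow_injective ht
        simp only [Prod.mk.injEq] at this
        exact hg this.1.symm
      simp [crossing_of_not _ _ _ _ _ _ h, G.inner_arrow]
    · have h : ¬ ∃ t, H.arrow (e, t) = H.arrow (g, i, b) := by
        rintro ⟨t, ht⟩
        have := H.arrow_injective ht
        simp only [Prod.mk.injEq] at this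
        exact hg this.1.symm
      simp [crossing_of_not _ _ _ _ _ _ h, H.inner_arrow]

/-- The equivalence relation on the points of a 2-sum that is generated by equivalence relations on
the points of the two summands and by the identification of the ends of the arrows of `f` with the
ends of the corresponding arrows of `e`. -/
def glue (G H : ArrowPresentation.{u}) (f : G.Edge) (e : H.Edge) (φ : Coupling)
    (R : Setoid G.Pt) (S : Setoid H.Pt) : Setoid (G.Pt ⊕ H.Pt) :=
  Relation.EqvGen.setoid fun p q =>
    Sum.LiftRel (fun x y => R x y) (fun x y => S x y) p q ∨
      ∃ i b, p = Sum.inl (G.arrow (f, i, b)) ∧ q = Sum.inr (H.arrow (e, φ i, b))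

theorem glue_inl (G H : ArrowPresentation.{u}) (f : G.Edge) (e : H.Edge) (φ : Coupling)
    (R : Setoid G.Pt) (S : Setoid H.Pt) {x y : G.Pt} (h : R x y) :
    G.glue H f e φ R S (Sum.inl x) (Sum.inl y) :=
  Relation.EqvGen.rel _ _ (Or.inl (Sum.LiftRel.inl h))

theorem glue_inr (G H : ArrowPresentation.{u}) (f : G.Edge) (e : H.Edge) (φ : Coupling)
    (R : Setoid G.Pt) (S : Setoid H.Pt) {x y : H.Pt} (h : S x y) :
    G.glue H f e φ R S (Sum.inr x) (Sum.inr y) :=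
  Relation.EqvGen.rel _ _ (Or.inl (Sum.LiftRel.inr h))

theorem glue_link (G H : ArrowPresentation.{u}) (f : G.Edge) (e : H.Edge) (φ : Coupling)
    (R : Setoid G.Pt) (S : Setoid H.Pt) (i b : Bool) :
    G.glue H f e φ R S (Sum.inl (G.arrow (f, i, b))) (Sum.inr (H.arrow (e, φ i, b))) :=
  Relation.EqvGen.rel _ _ (Or.inr ⟨i, b, rfl, rfl⟩)

theorem glue_inner (G H : ArrowPresentation.{u}) (f : G.Edge) (e : H.Edge) (φ : Coupling)
    (R : Setoid G.Pt) (S : Setoid H.Pt) (p : G.Pt ⊕ H.Pt)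
    (hR : ∀ x, p = Sum.inl x → (¬ ∃ t, G.arrow (f, t) = x) → R x (G.inner x))
    (hS : ∀ x, p = Sum.inr x → (¬ ∃ t, H.arrow (e, t) = x) → S x (H.inner x)) :
    G.glue H f e φ R S p ((G.twoSum H f e φ).inner p) := by
  rcases p with p | p
  · change G.glue H f e φ R S (Sum.inl p) (G.crossing H f e φ p)
    by_cases h : ∃ t, G.arrow (f, t) = p
    · obtain ⟨⟨i, b⟩, rfl⟩ := h
      rw [crossing_arrow]
      exact glue_link _ _ _ _ _ _ _ i b
    · rw [crossing_of_not _ _ _ _ _ _ h]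
      exact glue_inl _ _ _ _ _ _ _ (hR p rfl h)
  · change G.glue H f e φ R S (Sum.inr p) (H.crossing G e f φ.symm p).swap
    by_cases h : ∃ t, H.arrow (e, t) = p
    · obtain ⟨⟨i, b⟩, rfl⟩ := h
      rw [crossing_arrow]
      refine Setoid.symm' _ ?_
      simpa using glue_link G H f e φ R S (φ.symm i) b
    · rw [crossing_of_not _ _ _ _ _ _ h]
      exact glue_inr _ _ _ _ _ _ _ (hS p rfl h)

theorem vertexSetoid_twoSum_le (G H : ArrowPresentation.{u}) (f : G.Edge) (e : H.Edge)
    (φ : Coupling) (R : Setoid G.Pt) (S : Setoid H.Pt) (hR : G.vertexSetoid ≤ R)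
    (hS : H.vertexSetoid ≤ S) : (G.twoSum H f e φ).vertexSetoid ≤ G.glue H f e φ R S := by
  refine Setoid.eqvGen_le (r := fun p q : G.Pt ⊕ H.Pt =>
    q = (G.twoSum H f e φ).outer p ∨ q = (G.twoSum H f e φ).inner p) ?_
  rintro p q (rfl | rfl)
  · rcases p with p | p
    · exact glue_inl _ _ _ _ _ _ _ (hR (Relation.EqvGen.rel _ _ (Or.inl rfl)))
    · exact glue_inr _ _ _ _ _ _ _ (hS (Relation.EqvGen.rel _ _ (Or.inl rfl)))
  · exact glue_inner _ _ _ _ _ _ _ _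
      (fun x _ _ => hR (Relation.EqvGen.rel _ _ (Or.inr rfl)))
      (fun x _ _ => hS (Relation.EqvGen.rel _ _ (Or.inr rfl)))

theorem boundarySetoid_twoSum_le (G H : ArrowPresentation.{u}) (f : G.Edge) (e : H.Edge)
    (φ : Coupling) (R : Setoid G.Pt) (S : Setoid H.Pt) (hR : G.boundarySetoid ≤ R)
    (hS : H.boundarySetoid ≤ S) : (G.twoSum H f e φ).boundarySetoid ≤ G.glue H f e φ R S := by
  refine Setoid.eqvGen_le (r := fun p q : G.Pt ⊕ H.Pt =>
    q = (G.twoSum H f e φ).outer p ∨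
    (p ∉ Set.range (G.twoSum H f e φ).arrow ∧ q = (G.twoSum H f e φ).inner p) ∨
      ∃ (g : (G.twoSum H f e φ).Edge) (i b : Bool),
        p = (G.twoSum H f e φ).arrow (g, i, b) ∧
        q = (G.twoSum H f e φ).arrow (g, !i, !b)) ?_
  rintro p q (rfl | ⟨hp, rfl⟩ | ⟨g | g, i, b, rfl, rfl⟩)
  · rcases p with p | p
    · exact glue_inl _ _ _ _ _ _ _ (hR (Relation.EqvGen.rel _ _ (Or.inl rfl)))
    · exact glue_inr _ _ _ _ _ _ _ (hS (Relation.EqvGen.rel _ _ (Or.inl rfl)))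
  · refine glue_inner _ _ _ _ _ _ _ _ ?_ ?_
    · rintro x rfl hx
      refine hR (Relation.EqvGen.rel _ _ (Or.inr (Or.inl ⟨?_, rfl⟩)))
      rintro ⟨⟨g, t⟩, rfl⟩
      by_cases hg : g = f
      · subst hg
        exact hx ⟨t, rfl⟩
      · exact hp ⟨(Sum.inl ⟨g, hg⟩, t), rfl⟩
    · rintro x rfl hx
      refine hS (Relation.EqvGen.rel _ _ (Or.inr (Or.inl ⟨?_, rfl⟩)))
      rintro ⟨⟨g, t⟩, rfl⟩
      by_cases hg : g = e
      · subst hg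
        exact hx ⟨t, rfl⟩
      · exact hp ⟨(Sum.inr ⟨g, hg⟩, t), rfl⟩
  · exact glue_inl _ _ _ _ _ _ _
      (hR (Relation.EqvGen.rel _ _ (Or.inr (Or.inr ⟨g.1, i, b, rfl, rfl⟩))))
  · exact glue_inr _ _ _ _ _ _ _
      (hS (Relation.EqvGen.rel _ _ (Or.inr (Or.inr ⟨g.1, i, b, rfl, rfl⟩))))

end ArrowPresentation

/-! ### Packaged arrow presentations -/

/-- A packaged arrow presentation: an arrow presentation with a partition of its vertices and a
partition of its boundary components. A partition of the set of vertices (boundary components) is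
given by the corresponding equivalence relation on the points, which is any equivalence relation
that relates points on the same vertex (boundary component). -/
structure PackagedArrowPresentation : Type (u + 1) extends ArrowPresentation.{u} where
  /-- the vertex partition -/
  vertexPartition : Setoid Pt
  vertex_le : toArrowPresentation.vertexSetoid ≤ vertexPartition
  /-- the boundary partition -/
  boundaryPartition : Setoid Pt
  boundary_le : toArrowPresentation.boundarySetoid ≤ boundaryPartition

/-- The equivalence relation obtained from `R` by merging the classes of `x` and `y`. -/
def mergeClasses {α : Type u} (R : Setoid α) (x y : α) : Setoid α :=
  R ⊔ Relation.EqvGen.setoid fun p q => p = x ∧ q = y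

theorem le_mergeClasses {α : Type u} (R : Setoid α) (x y : α) : R ≤ mergeClasses R x y :=
  le_sup_left

theorem mergeClasses_rel {α : Type u} (R : Setoid α) (x y : α) : mergeClasses R x y x y :=
  (le_sup_right : _ ≤ mergeClasses R x y) (Relation.EqvGen.rel _ _ ⟨rfl, rfl⟩)

namespace PackagedArrowPresentation

open ArrowPresentation

theorem vertex_inner (G : PackagedArrowPresentation.{u}) (e : G.Edge) (i b c : Bool) :
    G.vertexPartition (G.arrow (e, i, b)) (G.arrow (e, i, c)) := by
  by_cases h : c = b
  · subst h
    exact Setoid.refl' _ _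
  · have h2 : c = !b := by revert h; cases b <;> cases c <;> decide
    subst h2
    exact G.vertex_le (Relation.EqvGen.rel _ _ (Or.inr (G.inner_arrow e i b).symm))

theorem boundary_cross (G : PackagedArrowPresentation.{u}) (e : G.Edge) (i b : Bool) :
    G.boundaryPartition (G.arrow (e, i, b)) (G.arrow (e, !i, !b)) :=
  G.boundary_le (Relation.EqvGen.rel _ _ (Or.inr (Or.inr ⟨e, i, b, rfl, rfl⟩)))

/-- The vertex partition with the classes of the two vertices incident with `e` merged. -/
def mergedVertices (G : PackagedArrowPresentation.{u}) (e : G.Edge) : Setoid G.Pt :=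
  mergeClasses G.vertexPartition (G.arrow (e, false, false)) (G.arrow (e, true, false))

/-- The boundary partition with the classes of the two boundary components incident with `e`
(through the tail and through the head of an arrow of `e`) merged. -/
def mergedBoundary (G : PackagedArrowPresentation.{u}) (e : G.Edge) : Setoid G.Pt :=
  mergeClasses G.boundaryPartition (G.arrow (e, false, false)) (G.arrow (e, false, true))

theorem mergedVertices_all (G : PackagedArrowPresentation.{u}) (e : G.Edge) (s t : Bool × Bool) :
    G.mergedVertices e (G.arrow (e, s)) (G.arrow (e, t)) := by
  have key : ∀ s : Bool × Bool,
      G.mergedVertices e (G.arrow (e, s)) (G.arrow (e, false, false)) := by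
    rintro ⟨i, b⟩
    have h := le_mergeClasses G.vertexPartition (G.arrow (e, false, false))
      (G.arrow (e, true, false)) (G.vertex_inner e i b false)
    cases i
    · exact h
    · exact Setoid.trans' _ h (Setoid.symm' _ (mergeClasses_rel _ _ _))
  exact Setoid.trans' _ (key s) (Setoid.symm' _ (key t))

theorem mergedBoundary_all (G : PackagedArrowPresentation.{u}) (e : G.Edge) (s t : Bool × Bool) :
    G.mergedBoundary e (G.arrow (e, s)) (G.arrow (e, t)) := by
  have key0 : ∀ b : Bool,
      G.mergedBoundary e (G.arrow (e, false, b)) (G.arrow (e, false, false)) := by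
    rintro (_ | _)
    · exact Setoid.refl' _ _
    · exact Setoid.symm' _ (mergeClasses_rel _ _ _)
  have key : ∀ s : Bool × Bool,
      G.mergedBoundary e (G.arrow (e, s)) (G.arrow (e, false, false)) := by
    rintro ⟨i, b⟩
    cases i
    · exact key0 b
    · exact Setoid.trans' _ (le_mergeClasses G.boundaryPartition _ _ (G.boundary_cross e true b))
        (key0 (!b))
  exact Setoid.trans' _ (key s) (Setoid.symm' _ (key t))

/-- Deletion. -/
noncomputable def delete (G : PackagedArrowPresentation.{u}) (e : G.Edge) :
    PackagedArrowPresentation.{u} where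
  toArrowPresentation := G.toArrowPresentation.delete e
  vertexPartition := G.vertexPartition
  vertex_le := vertexSetoid_resolve_le _ _ _ _ _ _ G.vertex_le fun t => G.vertex_inner e t.1 t.2 _
  boundaryPartition := G.mergedBoundary e
  boundary_le := boundarySetoid_resolve_le _ _ _ _ _ _
    (G.boundary_le.trans (le_mergeClasses _ _ _)) fun _ => G.mergedBoundary_all e _ _

/-- Merge-deletion. -/
noncomputable def mergeDelete (G : PackagedArrowPresentation.{u}) (e : G.Edge) :
    PackagedArrowPresentation.{u} where
  toArrowPresentation := G.toArrowPresentation.delete e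
  vertexPartition := G.mergedVertices e
  vertex_le := vertexSetoid_resolve_le _ _ _ _ _ _
    (G.vertex_le.trans (le_mergeClasses _ _ _)) fun _ => G.mergedVertices_all e _ _
  boundaryPartition := G.mergedBoundary e
  boundary_le := boundarySetoid_resolve_le _ _ _ _ _ _
    (G.boundary_le.trans (le_mergeClasses _ _ _)) fun _ => G.mergedBoundary_all e _ _

/-- Contraction. -/
noncomputable def contract (G : PackagedArrowPresentation.{u}) (e : G.Edge) :
    PackagedArrowPresentation.{u} where
  toArrowPresentation := G.toArrowPresentation.contract e
  vertexPartition := G.mergedVertices e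
  vertex_le := vertexSetoid_resolve_le _ _ _ _ _ _
    (G.vertex_le.trans (le_mergeClasses _ _ _)) fun _ => G.mergedVertices_all e _ _
  boundaryPartition := G.boundaryPartition
  boundary_le := boundarySetoid_resolve_le _ _ _ _ _ _ G.boundary_le
    fun t => G.boundary_cross e t.1 t.2

/-- Merge-contraction. -/
noncomputable def mergeContract (G : PackagedArrowPresentation.{u}) (e : G.Edge) :
    PackagedArrowPresentation.{u} where
  toArrowPresentation := G.toArrowPresentation.contract e
  vertexPartition := G.mergedVertices e
  vertex_le := vertexSetoid_resolve_le _ _ _ _ _ _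
    (G.vertex_le.trans (le_mergeClasses _ _ _)) fun _ => G.mergedVertices_all e _ _
  boundaryPartition := G.mergedBoundary e
  boundary_le := boundarySetoid_resolve_le _ _ _ _ _ _
    (G.boundary_le.trans (le_mergeClasses _ _ _)) fun _ => G.mergedBoundary_all e _ _

/-- Penrose-contraction. -/
noncomputable def penrose (G : PackagedArrowPresentation.{u}) (e : G.Edge) :
    PackagedArrowPresentation.{u} where
  toArrowPresentation := G.toArrowPresentation.penrose e
  vertexPartition := G.mergedVertices e
  vertex_le := vertexSetoid_resolve_le _ _ _ _ _ _
    (G.vertex_le.trans (le_mergeClasses _ _ _)) fun _ => G.mergedVertices_all e _ _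
  boundaryPartition := G.mergedBoundary e
  boundary_le := boundarySetoid_resolve_le _ _ _ _ _ _
    (G.boundary_le.trans (le_mergeClasses _ _ _)) fun _ => G.mergedBoundary_all e _ _

/-- The number of vertices. -/
noncomputable def numVertices (G : PackagedArrowPresentation.{u}) : ℕ := Nat.card G.Vertex

/-- The number of blocks of the vertex partition. -/
noncomputable def numVertexClasses (G : PackagedArrowPresentation.{u}) : ℕ :=
  Nat.card (Quotient G.vertexPartition)

/-- The number of blocks of the boundary partition. -/
noncomputable def numBoundaryClasses (G : PackagedArrowPresentation.{u}) : ℕ :=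
  Nat.card (Quotient G.boundaryPartition)

/-- The 2-sum of packaged arrow presentations. If an arrow of `f` lies on the vertex `u` and `φ` sends
it to an arrow on the vertex `u'`, then the classes of `u` and `u'` are united, and the vertices of
the 2-sum through the ends of these arrows lie in the resulting class. The boundary classes are
treated in the same way, with the boundary components through the ends of the arrows. -/
noncomputable def twoSum (G H : PackagedArrowPresentation.{u}) (f : G.Edge) (e : H.Edge)
    (φ : Coupling) : PackagedArrowPresentation.{u} where
  toArrowPresentation := G.toArrowPresentation.twoSum H.toArrowPresentation f e φ
  vertexPartition := glue _ _ f e φ G.vertexPartition H.vertexPartition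
  vertex_le := vertexSetoid_twoSum_le _ _ _ _ _ _ _ G.vertex_le H.vertex_le
  boundaryPartition := glue _ _ f e φ G.boundaryPartition H.boundaryPartition
  boundary_le := boundarySetoid_twoSum_le _ _ _ _ _ _ _ G.boundary_le H.boundary_le

/-- `IteratedTwoSum H e P φ R`: the packaged arrow presentation `R` is obtained from `P` by forming,
one after the other and in some order, 2-sums with copies of `H` (along the edge `e` of each copy)
at all the edges `f` of `P` for which a coupling `φ f` is prescribed. -/
inductive IteratedTwoSum (H : PackagedArrowPresentation.{u}) (e : H.Edge) :
    (P : PackagedArrowPresentation.{u}) → (P.Edge → Option Coupling) →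
      PackagedArrowPresentation.{u} → Prop
  | done (P : PackagedArrowPresentation.{u}) (φ : P.Edge → Option Coupling)
      (h : ∀ g, φ g = none) : IteratedTwoSum H e P φ P
  | step (P : PackagedArrowPresentation.{u}) (φ : P.Edge → Option Coupling)
      (R : PackagedArrowPresentation.{u}) (f : P.Edge) (c : Coupling) (hf : φ f = some c)
      (h : IteratedTwoSum H e (P.twoSum H f e c)
        (Sum.elim (fun g => φ g.1) (fun _ => none)) R) : IteratedTwoSum H e P φ R

/-- `R` is a tensor product of `G` and `H` with respect to the couplings `φ f` of the edges `f` of `G`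
with the edge `e` of `H`: it arises from `G` by taking, for each edge `f` of `G`, the 2-sum with a
copy of `H` with respect to `φ f`. All orders of the edges of `G` are allowed. -/
def IsTensorProduct (G H : PackagedArrowPresentation.{u}) (e : H.Edge) (φ : G.Edge → Coupling)
    (R : PackagedArrowPresentation.{u}) : Prop :=
  IteratedTwoSum H e G (fun f => some (φ f)) R

theorem exists_iteratedTwoSum (H : PackagedArrowPresentation.{u}) (e : H.Edge) (n : ℕ) :
    ∀ (P : PackagedArrowPresentation.{u}) (φ : P.Edge → Option Coupling),
      Nat.card {g // φ g ≠ none} = n → ∃ R, IteratedTwoSum H e P φ R := by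
  induction n with
  | zero =>
    intro P φ h
    have := P.finite_edge
    rw [Finite.card_eq_zero_iff] at h
    exact ⟨P, .done P φ fun g => by_contra fun hg => h.false ⟨g, hg⟩⟩
  | succ n ih =>
    intro P φ h
    have := P.finite_edge
    have hpos : 0 < Nat.card {g // φ g ≠ none} := by omega
    obtain ⟨⟨f, hf⟩⟩ := (Finite.card_pos_iff).1 hpos
    obtain ⟨c, hc⟩ := Option.ne_none_iff_exists'.1 hf
    obtain ⟨R, hR⟩ := ih (P.twoSum H f e c) (Sum.elim (fun g => φ g.1) (fun _ => none)) (by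
      have h1 : Nat.card {x : {g // φ g ≠ none} // x ≠ ⟨f, hf⟩} = n := by
        have := Set.ncard_sdiff_singleton_add_one (s := (Set.univ : Set {g // φ g ≠ none}))
          (Set.mem_univ ⟨f, hf⟩) (Set.toFinite _)
        rw [Set.ncard_univ, h] at this
        have h3 : (Set.univ \ {(⟨f, hf⟩ : {g // φ g ≠ none})}).ncard
            = Nat.card {x : {g // φ g ≠ none} // x ≠ ⟨f, hf⟩} := by
          rw [← Nat.card_coe_set_eq]
          exact Nat.card_congr (Equiv.subtypeEquivRight (by simp))
        omega
      rw [← h1]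
      refine Nat.card_congr ⟨fun x => ?_, fun x => ⟨Sum.inl ⟨x.1.1, fun h => x.2 (Subtype.ext h)⟩,
        x.1.2⟩, ?_, ?_⟩
      · match x with
        | ⟨Sum.inl g, hg⟩ => exact ⟨⟨g.1, hg⟩, fun h => g.2 (congrArg (fun y => y.1) h)⟩
        | ⟨Sum.inr g, hg⟩ => exact absurd rfl hg
      · rintro ⟨g | g, hg⟩
        · rfl
        · exact absurd rfl hg
      · intro x
        rfl)
    exact ⟨R, .step P φ R f c hc hR⟩

theorem exists_isTensorProduct (G H : PackagedArrowPresentation.{u}) (e : H.Edge)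
    (φ : G.Edge → Coupling) : ∃ R, IsTensorProduct G H e φ R :=
  exists_iteratedTwoSum H e _ G _ rfl

end PackagedArrowPresentation

/-! ### The polynomials -/

/-- The variables of the polynomial `Z`. -/
inductive ZVar
  | a | b | α | β | γ

/-- The variables of the polynomial `Q`. -/
inductive QVar
  | a | b | c | x | y | α | β | γ

open PackagedArrowPresentation in
/-- The deletion-contraction relation, for every edge, and the values on edgeless packaged arrow
presentations that define `Z`. -/
def IsZPolynomial (Z : PackagedArrowPresentation.{u} → MvPolynomial ZVar ℤ) : Prop :=
  (∀ (G : PackagedArrowPresentation.{u}) (e : G.Edge),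
    Z G = .X .a * Z (G.delete e) + .X .b * Z (G.contract e)) ∧
  ∀ G : PackagedArrowPresentation.{u}, IsEmpty G.Edge →
    Z G = .X .α ^ G.numVertices * .X .β ^ G.numVertexClasses * .X .γ ^ G.numBoundaryClasses

open PackagedArrowPresentation in
/-- The five-term relation, for every edge, and the values on edgeless packaged arrow presentations
that define `Q`. -/
def IsQPolynomial (Q : PackagedArrowPresentation.{u} → MvPolynomial QVar ℤ) : Prop :=
  (∀ (G : PackagedArrowPresentation.{u}) (e : G.Edge),
    Q G = .X .a * Q (G.delete e) + .X .b * Q (G.contract e) + .X .c * Q (G.penrose e) +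
      .X .x * Q (G.mergeDelete e) + .X .y * Q (G.mergeContract e)) ∧
  ∀ G : PackagedArrowPresentation.{u}, IsEmpty G.Edge →
    Q G = .X .α ^ G.numVertices * .X .β ^ G.numVertexClasses * .X .γ ^ G.numBoundaryClasses

/-- The field of fractions of `ℤ[a, b, α, β, γ]`. -/
abbrev ZField : Type := FractionRing (MvPolynomial ZVar ℤ)

/-- The image of a polynomial in `ℤ[a, b, α, β, γ]` in the field of fractions. -/
noncomputable abbrev toZField (p : MvPolynomial ZVar ℤ) : ZField :=
  algebraMap (MvPolynomial ZVar ℤ) ZField p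

/-- A variable of `Z` as an element of the field of fractions. -/
noncomputable abbrev zVar (v : ZVar) : ZField := toZField (.X v)

/-- The coefficient matrix of the linear system. -/
noncomputable def tensorMatrix : Matrix (Fin 5) (Fin 5) ZField :=
  (zVar .α * zVar .β * zVar .γ) •
    !![zVar .α * zVar .β, 1, 1, zVar .α, 1;
       1, zVar .α * zVar .γ, 1, 1, zVar .α;
       1, 1, zVar .α, 1, 1;
       zVar .α, 1, 1, zVar .α, 1;
       1, zVar .α, 1, 1, zVar .α]

/-- The right-hand side of the linear system. -/
noncomputable def tensorVector (Z : PackagedArrowPresentation.{u} → MvPolynomial ZVar ℤ)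
    (H : PackagedArrowPresentation.{u}) (e : H.Edge) : Fin 5 → ZField :=
  ![toZField (Z (H.delete e)), toZField (Z (H.contract e)), toZField (Z (H.penrose e)),
    toZField (Z (H.mergeDelete e)), toZField (Z (H.mergeContract e))]

/-- The value `q(φ₀, φ₁, φ₂, φ₃, φ₄, α, β, γ)` of a polynomial `q` in the variables
`a, b, c, x, y, α, β, γ`. -/
noncomputable def evalQ (φ : Fin 5 → ZField) (q : MvPolynomial QVar ℤ) : ZField :=
  MvPolynomial.aeval
    (fun
      | QVar.a => φ 0
      | QVar.b => φ 1
      | QVar.c => φ 2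
      | QVar.x => φ 3
      | QVar.y => φ 4
      | QVar.α => zVar .α
      | QVar.β => zVar .β
      | QVar.γ => zVar .γ) q

/-! ### Generated equivalence relations -/

namespace Setoid

variable {A B E F : Type*}

/-! A recursion that removes one edge at a time unfolds into a sum over states, a state being a
choice of one of the five operations for every edge. Three equivalence relations on the marked
points are tracked: the components of the circles without the arcs that carry arrows, the vertex
partition and the boundary partition. Every operation joins each of them with a fixed relation on
the four arrow ends of its edge (`opSetoid`), and joins commute. So the state sum satisfies the
five-term relation and is its only solution, which yields existence and uniqueness of both
polynomials; `Z` is the case of coefficients `a, b, 0, 0, 0`.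

For a 2-sum, fix a state of `H` on all edges except `e`. Seen from `G`, it matters only how this
state relates the four ends at `e`. The arcs join these ends in pairs, in one of three ways. The
vertex and boundary relations contain this pairing; the former also relates the two ends of each
arrow, and the latter relates each tail to the opposite head. Exactly five triples are possible, and
they are those of the five operations (`exists_type`). Hence the state acts on `G` like an operation
at `f`, times variables for the classes of `H` that avoid `e`. Collecting the states by type gives
five weights that depend only on `H` and `e`, and the 2-sum has the state sum of `G` with these
weights at `f` (`stateSum_glueAlong`). Doing this at every edge turns the tensor product into `Q` at
these weights.

Resolving `e` in `H` by operation `i` and counting in the same way expresses the result as the sum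
over `j` of `pairing x i j` times the weight of type `j` (`stateSum_sup_map`). This is the linear
system, and `det_tensorMatrix_ne_zero` makes its solution unique. -/

theorem eqvGen_setoid_le_iff {r : A → A → Prop} {T : Setoid A} :
    Relation.EqvGen.setoid r ≤ T ↔ ∀ x y, r x y → T x y :=
  ⟨fun h _ _ hxy => h (Relation.EqvGen.rel _ _ hxy), fun h => eqvGen_le h⟩

theorem map_le_iff_le_comap {f : A → B} {s : Setoid A} {T : Setoid B} :
    s.map f ≤ T ↔ s ≤ T.comap f := by
  refine eqvGen_setoid_le_iff.trans ⟨fun h x y hxy => h _ _ ⟨x, y, hxy, rfl, rfl⟩, ?_⟩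
  rintro h _ _ ⟨x, y, hxy, rfl, rfl⟩
  exact h hxy

theorem comap_mono {f : A → B} {S T : Setoid B} (h : S ≤ T) : S.comap f ≤ T.comap f :=
  fun _ _ hxy => h hxy

/-- The equivalence relation obtained from `R` by identifying, for each `e`, the points
`arrow (e, t)` according to `s e`. -/
def smooth (R : Setoid A) (arrow : E × F → A) (s : E → Setoid F) : Setoid A :=
  R ⊔ ⨆ e, (s e).map fun t => arrow (e, t)

theorem smooth_le_iff {R : Setoid A} {arrow : E × F → A} {s : E → Setoid F} {T : Setoid A} :
    smooth R arrow s ≤ T ↔ R ≤ T ∧ ∀ e, s e ≤ T.comap fun t => arrow (e, t) := by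
  simp only [smooth, sup_le_iff, iSup_le_iff, map_le_iff_le_comap]

theorem le_smooth (R : Setoid A) (arrow : E × F → A) (s : E → Setoid F) : R ≤ smooth R arrow s :=
  le_sup_left

theorem smooth_of_isEmpty [IsEmpty E] (R : Setoid A) (arrow : E × F → A) (s : E → Setoid F) :
    smooth R arrow s = R := by
  simp [smooth]

/-- Two equivalence relations glued along the points `ι t` and `κ t`. -/
def glueAlong (ι : F → A) (κ : F → B) (R : Setoid A) (S : Setoid B) : Setoid (A ⊕ B) :=
  R.map Sum.inl ⊔ S.map Sum.inr ⊔
    Relation.EqvGen.setoid fun p q => ∃ t, p = Sum.inl (ι t) ∧ q = Sum.inr (κ t)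

theorem glueAlong_le_iff {ι : F → A} {κ : F → B} {R : Setoid A} {S : Setoid B}
    {T : Setoid (A ⊕ B)} : glueAlong ι κ R S ≤ T ↔
      R ≤ T.comap Sum.inl ∧ S ≤ T.comap Sum.inr ∧ ∀ t, T (Sum.inl (ι t)) (Sum.inr (κ t)) := by
  simp only [glueAlong, sup_le_iff, map_le_iff_le_comap, eqvGen_setoid_le_iff, and_assoc]
  refine and_congr_right fun _ => and_congr_right fun _ => ⟨fun h t => h _ _ ⟨t, rfl, rfl⟩, ?_⟩
  rintro h _ _ ⟨t, rfl, rfl⟩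
  exact h t

theorem glueAlong_le_comap_swap (ι : F → A) (κ : F → B) (R : Setoid A) (S : Setoid B) :
    glueAlong κ ι S R ≤ (glueAlong ι κ R S).comap Sum.swap := by
  obtain ⟨hG1, hG2, hG3⟩ := glueAlong_le_iff.1 (le_refl (glueAlong ι κ R S))
  exact glueAlong_le_iff.2 ⟨hG2, hG1, fun t => Setoid.symm' _ (hG3 t)⟩

/-- Both sides are generated by the same identifications, so they have the same upper bounds. This
separates a state of a 2-sum into states of its two summands. -/
theorem smooth_glueAlong {E' : Type*} (ι : F → A) (κ : F → B) (R : Setoid A) (S : Setoid B)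
    (arrow : E × F → A) (arrow' : E' × F → B) (s : E ⊕ E' → Setoid F) :
    smooth (glueAlong ι κ R S)
      (fun t => Sum.elim (fun g => Sum.inl (arrow (g, t.2))) (fun h => Sum.inr (arrow' (h, t.2))) t.1)
      s = glueAlong ι κ (smooth R arrow fun g => s (.inl g)) (smooth S arrow' fun h => s (.inr h)) := by
  refine eq_of_forall_ge_iff fun T => ?_
  simp only [smooth_le_iff, glueAlong_le_iff, Sum.forall, Sum.elim_inl, Sum.elim_inr]
  constructor
  · rintro ⟨⟨h1, h2, h3⟩, h4, h5⟩
    exact ⟨⟨h1, h4⟩, ⟨h2, h5⟩, h3⟩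
  · rintro ⟨⟨h1, h4⟩, ⟨h2, h5⟩, h3⟩
    exact ⟨⟨h1, h2, h3⟩, h4, h5⟩

theorem smooth_split (R : Setoid A) (arrow : E × F → A) (s : E → Setoid F) (e : E) :
    smooth R arrow s = smooth (R ⊔ (s e).map fun t => arrow (e, t))
      (fun t : {g // g ≠ e} × F => arrow (t.1, t.2)) fun g => s g := by
  refine eq_of_forall_ge_iff fun T => ?_
  simp only [smooth_le_iff, sup_le_iff, map_le_iff_le_comap, Subtype.forall]
  constructor
  · exact fun ⟨h1, h2⟩ => ⟨⟨h1, h2 e⟩, fun g _ => h2 g⟩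
  · rintro ⟨⟨h1, h2⟩, h3⟩
    refine ⟨h1, fun g => ?_⟩
    by_cases hg : g = e
    · exact hg ▸ h2
    · exact h3 g hg

theorem smooth_sup (R S : Setoid A) (arrow : E × F → A) (s : E → Setoid F) :
    smooth (R ⊔ S) arrow s = smooth R arrow s ⊔ S := by
  simp only [smooth, sup_assoc, sup_comm S]

/-! ### Numbers of classes of glued relations. -/

theorem card_quotient_ker (f : A → B) (hf : Function.Surjective f) :
    Nat.card (Quotient (ker f)) = Nat.card B :=
  Nat.card_congr (quotientKerEquivOfSurjective f hf)

open Classical in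
/-- The classes of two glued equivalence relations are the classes of the first one, after the
identifications made by the second one, and the classes of the second one that are not involved
in the gluing. -/
theorem card_glueAlong [Finite A] [Finite B] (ι : F → A) (κ : F → B) (R : Setoid A)
    (S : Setoid B) : Nat.card (Quotient (glueAlong ι κ R S)) =
      Nat.card (Quotient (R ⊔ (S.comap κ).map ι)) +
        Nat.card {c : Quotient S // ∀ t, c ≠ Quotient.mk S (κ t)} := by
  set R' := R ⊔ (S.comap κ).map ι with hR'
  -- The target has the required cardinality. A class of `S` that meets the gluing points is sent to
  -- the class of any `ι t` glued to it; the join in `R'` makes the choice of `t` irrelevant. The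
  -- glued relation turns out to be the kernel of `f`.
  let f : A ⊕ B → Quotient R' ⊕ {c : Quotient S // ∀ t, c ≠ Quotient.mk S (κ t)} :=
    Sum.elim (fun a => .inl (Quotient.mk R' a)) fun b =>
      if h : ∃ t, S b (κ t) then .inl (Quotient.mk R' (ι h.choose))
      else .inr ⟨Quotient.mk S b, fun t ht => h ⟨t, Quotient.exact ht⟩⟩
  have hpos : ∀ b t, S b (κ t) → f (.inr b) = .inl (Quotient.mk R' (ι t)) := by
    intro b t ht
    have h : ∃ t, S b (κ t) := ⟨t, ht⟩
    simp only [f, Sum.elim_inr, dif_pos h]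
    refine congrArg _ (Quotient.sound (show R' _ _ from ?_))
    exact (le_sup_right : _ ≤ R') (le_comap_map (f := ι) (S.trans' (S.symm' h.choose_spec) ht))
  have hneg : ∀ b (h : ¬ ∃ t, S b (κ t)), f (.inr b) =
      .inr ⟨Quotient.mk S b, fun t ht => h ⟨t, Quotient.exact ht⟩⟩ := by
    intro b h
    simp only [f, Sum.elim_inr, dif_neg h]
  have hsurj : Function.Surjective f := by
    rintro (c | ⟨c, hc⟩)
    · induction c using Quotient.inductionOn with
      | h a => exact ⟨.inl a, rfl⟩
    · induction c using Quotient.inductionOn with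
      | h b => exact ⟨.inr b, hneg b fun ⟨t, ht⟩ => hc t (Quotient.sound ht)⟩
  have hle : glueAlong ι κ R S ≤ ker f := by
    refine glueAlong_le_iff.2 ⟨?_, ?_, fun t => ?_⟩
    · intro x y h
      exact congrArg Sum.inl (Quotient.sound (show R' _ _ from (le_sup_left : R ≤ R') h))
    · intro x y h
      change f (.inr x) = f (.inr y)
      by_cases hx : ∃ t, S x (κ t)
      · obtain ⟨t, ht⟩ := hx
        rw [hpos x t ht, hpos y t (S.trans' (S.symm' h) ht)]
      · have hy : ¬ ∃ t, S y (κ t) := fun ⟨t, ht⟩ => hx ⟨t, S.trans' h ht⟩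
        rw [hneg x hx, hneg y hy]
        exact congrArg Sum.inr (Subtype.ext (Quotient.sound h))
    · exact (hpos _ t (S.refl' _)).symm
  obtain ⟨hG1, hG2, hG3⟩ := glueAlong_le_iff.1 (le_refl (glueAlong ι κ R S))
  have hR : R' ≤ (glueAlong ι κ R S).comap Sum.inl := by
    refine sup_le hG1 (map_le_iff_le_comap.2 fun s t hst => ?_)
    exact Setoid.trans' (glueAlong ι κ R S) (hG3 s)
      (Setoid.trans' _ (hG2 hst) (Setoid.symm' _ (hG3 t)))
  have hrep : ∀ p, (∃ a, glueAlong ι κ R S p (.inl a) ∧ f p = .inl (Quotient.mk R' a)) ∨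
      ∃ b hb, p = .inr b ∧ f p = .inr ⟨Quotient.mk S b, hb⟩ := by
    rintro (a | b)
    · exact .inl ⟨a, Setoid.refl' _ _, rfl⟩
    · by_cases h : ∃ t, S b (κ t)
      · obtain ⟨t, ht⟩ := h
        exact .inl ⟨ι t, Setoid.trans' _ (hG2 ht) (Setoid.symm' _ (hG3 t)), hpos b t ht⟩
      · exact .inr ⟨b, _, rfl, hneg b h⟩
  have heq : glueAlong ι κ R S = ker f := by
    refine le_antisymm hle fun p q hpq => ?_
    change f p = f q at hpq
    rcases hrep p with ⟨a, hp, ha⟩ | ⟨b, hb, rfl, hb'⟩ <;>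
      rcases hrep q with ⟨a', hq, ha'⟩ | ⟨c, hc, rfl, hc'⟩
    · rw [ha, ha'] at hpq
      have := hR (Quotient.exact (Sum.inl_injective hpq))
      exact Setoid.trans' _ hp (Setoid.trans' _ this (Setoid.symm' _ hq))
    · rw [ha, hc'] at hpq
      cases hpq
    · rw [hb', ha'] at hpq
      cases hpq
    · rw [hb', hc'] at hpq
      exact hG2 (Quotient.exact (congrArg Subtype.val (Sum.inr_injective hpq)))
  rw [heq, card_quotient_ker f hsurj, Nat.card_sum]

/-- The classes of `S` after further identifications among the points `κ t`. -/
theorem card_sup_map [Finite B] [Finite F] (κ : F → B) (R : Setoid F) (S : Setoid B) :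
    Nat.card (Quotient (S ⊔ R.map κ)) = Nat.card (Quotient (R ⊔ S.comap κ)) +
        Nat.card {c : Quotient S // ∀ t, c ≠ Quotient.mk S (κ t)} := by
  -- The gluing of `F` to `B` along `κ` is counted from both sides. Every class on `F` meets the
  -- gluing, so one of the two counts has no extra term.
  have h1 := card_glueAlong (id : F → F) κ R S
  have h2 := card_glueAlong κ (id : F → F) S R
  have h3 : IsEmpty {c : Quotient R // ∀ t, c ≠ Quotient.mk R (id t)} :=
    ⟨fun ⟨c, hc⟩ => hc c.out c.out_eq.symm⟩
  have h4 : (S.comap κ).map id = S.comap κ := by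
    refine eq_of_forall_ge_iff fun T => ?_
    rw [map_le_iff_le_comap, comap_id]
  rw [Nat.card_eq_zero.2 (.inl h3), add_zero, comap_id] at h2
  rw [h4] at h1
  rw [← h1, ← h2]
  have hswap : glueAlong κ (id : F → F) S R =
      (glueAlong (id : F → F) κ R S).comap Sum.swap := by
    refine le_antisymm (glueAlong_le_comap_swap _ _ _ _) fun p q hpq => ?_
    have h := glueAlong_le_comap_swap κ id S R
      (show glueAlong id κ R S p.swap q.swap from hpq)
    simpa [comap_rel] using h
  rw [hswap]
  exact Nat.card_congr (Quotient.congr (Equiv.sumComm _ _) fun _ _ => Iff.rfl)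

/-- A map onto `Bool` has a kernel with two classes, so one further relation already joins
everything. Consequently the join of any two of the three pairings of four ends is `⊤`. -/
theorem isCoatom_ker {f : A → Bool} (hf : Function.Surjective f) : IsCoatom (ker f) := by
  refine ⟨fun h => ?_, fun s hs => ?_⟩
  · obtain ⟨x, hx⟩ := hf false
    obtain ⟨y, hy⟩ := hf true
    have : ker f x y := h ▸ trivial
    rw [ker_def, hx, hy] at this
    cases this
  · obtain ⟨hle, hnot⟩ := hs
    obtain ⟨u, v, huv, hne⟩ : ∃ u v, s u v ∧ f u ≠ f v := by
      by_contra! h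
      exact hnot fun u v huv => h u v huv
    have key : ∀ x, s u x := by
      intro x
      by_cases h : f u = f x
      · exact hle h
      · refine s.trans' huv (hle (show f v = f x from ?_))
        revert h hne
        cases f u <;> cases f v <;> cases f x <;> decide
    exact top_unique fun x y _ => s.trans' (s.symm' (key x)) (key y)

/-- The curves that consist of the arcs of a perfect matching `o` and of a partial matching `i`,
whose free ends are the fixed points of `i`: every free end is on the same curve as exactly one
other free end. -/
theorem exists_unique_other_end [Finite A] {o i : A → A} (ho : Function.Involutive o)
    (ho' : ∀ p, o p ≠ p) (hi : Function.Involutive i) (x : A) (hx : i x = x) :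
    ∃ y, y ≠ x ∧ i y = y ∧ Relation.EqvGen.setoid (fun p q => q = o p ∨ q = i p) x y ∧
      ∀ z, i z = z → Relation.EqvGen.setoid (fun p q => q = o p ∨ q = i p) x z → z = x ∨ z = y := by
  set S : Setoid A := Relation.EqvGen.setoid fun p q => q = o p ∨ q = i p with hS
  let o' : Equiv.Perm A := ho.toPerm
  let i' : Equiv.Perm A := hi.toPerm
  -- The involutions generate a dihedral action, with `T` as rotation. As `i` fixes `x`, both `i`
  -- and `o` map the `T`-orbit of `x` to itself, by `n ↦ -n` and `n ↦ -n - 1` on exponents; so this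
  -- orbit is the whole curve.
  let T : Equiv.Perm A := i' * o'
  have hoo : o' * o' = 1 := Equiv.ext ho
  have hii : i' * i' = 1 := Equiv.ext hi
  have hTinv : T⁻¹ = o' * i' := by
    rw [mul_inv_rev, inv_eq_of_mul_eq_one_left hoo, inv_eq_of_mul_eq_one_left hii]
  have hsemi : SemiconjBy i' T T⁻¹ := by
    simp only [SemiconjBy, hTinv, T, mul_assoc, hii]
    rw [← mul_assoc i' i', hii, one_mul, mul_one]
  have hi_pow : ∀ n : ℤ, i ((T ^ n) x) = (T ^ (-n)) x := by
    intro n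
    have h := DFunLike.congr_fun (hsemi.zpow_right n).eq x
    rw [inv_zpow, ← zpow_neg] at h
    calc i ((T ^ n) x) = (T ^ (-n)) (i x) := h
      _ = _ := by rw [hx]
  have ho_pow : ∀ n : ℤ, o ((T ^ n) x) = (T ^ (-n - 1)) x := by
    intro n
    have h : o' = i' * T := by rw [← mul_assoc, hii, one_mul]
    calc o ((T ^ n) x) = (i' * T) ((T ^ n) x) := by rw [← h]; rfl
      _ = i ((T ^ (1 + n)) x) := by rw [zpow_add, zpow_one]; rfl
      _ = _ := by rw [hi_pow]; congr 2; ring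
  have hS_pow : ∀ z, S x z → ∃ n : ℤ, (T ^ n) x = z := by
    have hle : S ≤ ker fun p => ∃ n : ℤ, (T ^ n) x = p := by
      have hstep : ∀ p, (∃ n : ℤ, (T ^ n) x = p) →
          (∃ n : ℤ, (T ^ n) x = o p) ∧ ∃ n : ℤ, (T ^ n) x = i p := by
        rintro _ ⟨n, rfl⟩
        exact ⟨⟨_, (ho_pow n).symm⟩, ⟨_, (hi_pow n).symm⟩⟩
      refine eqvGen_setoid_le_iff.2 ?_
      rintro p _ (rfl | rfl)
      · refine propext ⟨fun h => (hstep p h).1, fun h => ?_⟩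
        have := (hstep _ h).1
        rwa [ho p] at this
      · refine propext ⟨fun h => (hstep p h).2, fun h => ?_⟩
        have := (hstep _ h).2
        rwa [hi p] at this
    intro z hz
    have h : (∃ n : ℤ, (T ^ n) x = x) = ∃ n : ℤ, (T ^ n) x = z := hle hz
    exact h ▸ ⟨0, rfl⟩
  have hpow_S : ∀ n : ℕ, S x ((T ^ n) x) := by
    intro n
    induction n with
    | zero => exact S.refl' x
    | succ n ih =>
      rw [pow_succ']
      exact S.trans' ih (S.trans' (Relation.EqvGen.rel _ _ (.inl rfl))
        (Relation.EqvGen.rel _ _ (.inr rfl)))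
  set N := Function.minimalPeriod (T • ·) x with hN
  have hdvd : ∀ {n : ℤ}, (T ^ n) x = x ↔ (N : ℤ) ∣ n :=
    fun {n} => MulAction.zpow_smul_eq_iff_minimalPeriod_dvd (a := T) (b := x)
  have hdvd' : ∀ {n m : ℤ}, (T ^ n) x = (T ^ m) x ↔ (N : ℤ) ∣ n - m := by
    intro n m
    rw [← hdvd, ← neg_add_eq_sub, zpow_add, Equiv.Perm.mul_apply, zpow_neg, Equiv.Perm.inv_eq_iff_eq]
  have hN0 : N ≠ 0 := by
    intro h
    have h1 : (T ^ ((orderOf T : ℕ) : ℤ)) x = x := by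
      rw [zpow_natCast, pow_orderOf_eq_one]; rfl
    rw [hdvd, h] at h1
    rw [Nat.cast_zero, zero_dvd_iff, Nat.cast_eq_zero] at h1
    exact (orderOf_pos T).ne' h1
  -- `i` fixes `T ^ n x` iff the period `N` divides `2n`. For `N = 2k` this leaves exactly the
  -- exponents `0` and `k` modulo `N`.
  rcases Nat.even_or_odd' N with ⟨k, hk | hk⟩
  · refine ⟨(T ^ (k : ℤ)) x, ?_, ?_, ?_, ?_⟩
    · rw [Ne, hdvd, hk]
      intro h
      have := Int.le_of_dvd (by omega) h
      push_cast at this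
      omega
    · rw [hi_pow, hdvd', hk]
      exact ⟨-1, by push_cast; ring⟩
    · rw [zpow_natCast]
      exact hpow_S k
    · intro z hz hxz
      obtain ⟨n, rfl⟩ := hS_pow z hxz
      rw [hi_pow, hdvd', hk] at hz
      obtain ⟨q, hq⟩ := hz
      push_cast at hq
      have hn : n = -(k * q) := by linarith
      rcases Int.even_or_odd' q with ⟨r, rfl | rfl⟩
      · left
        rw [hdvd, hk, hn]
        exact ⟨-r, by push_cast; ring⟩
      · right
        rw [hdvd', hk, hn]
        exact ⟨-r - 1, by push_cast; ring⟩
  -- An odd period `N = 2k + 1` would make `T ^ k x` a fixed point of `o`, since `-k - 1` and `k`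
  -- agree modulo `N`.
  · refine absurd (?_ : o ((T ^ (k : ℤ)) x) = (T ^ (k : ℤ)) x) (ho' _)
    rw [ho_pow, hdvd', hk]
    exact ⟨-1, by push_cast; ring⟩

end Setoid

/-! ### The five ways to resolve an edge -/

namespace ArrowPresentation

open Setoid

/-- The equivalence relations on the ends of the two arrows of an edge `e` by which the set of
circles (`0`), the vertex partition (`1`) and the boundary partition (`2`) are changed when `e` is
deleted (`0`), contracted (`1`), Penrose-contracted (`2`), merge-deleted (`3`) or merge-contracted
(`4`). -/
def opSetoid : Fin 5 → Fin 3 → Setoid (Bool × Bool) :=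
  ![![ker Prod.fst, ker Prod.fst, ⊤], ![ker fun t => t.1 ^^ t.2, ⊤, ker fun t => t.1 ^^ t.2],
    ![ker Prod.snd, ⊤, ⊤], ![ker Prod.fst, ⊤, ⊤], ![ker fun t => t.1 ^^ t.2, ⊤, ⊤]]

/-- The way in which the ends of the arrows of an edge are joined by the five operations. -/
def opMatch : Fin 5 → Bool × Bool → Bool × Bool :=
  ![fun t => (t.1, !t.2), fun t => (!t.1, !t.2), fun t => (!t.1, t.2), fun t => (t.1, !t.2),
    fun t => (!t.1, !t.2)]

theorem opMatch_opMatch (j : Fin 5) (t : Bool × Bool) : opMatch j (opMatch j t) = t := by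
  revert j t; decide

theorem opMatch_ne (j : Fin 5) (t : Bool × Bool) : opMatch j t ≠ t := by
  revert j t; decide

theorem le_iff_of_forall_ker {α : Type*} {f : Bool × Bool → α} {m : Bool × Bool → Bool × Bool}
    (hf : ∀ s t, f s = f t ↔ t = s ∨ t = m s) {T : Setoid (Bool × Bool)} :
    ker f ≤ T ↔ ∀ t, T t (m t) := by
  refine ⟨fun h t => h ((hf t (m t)).2 (.inr rfl)), fun h s t hst => ?_⟩
  rcases (hf s t).1 hst with rfl | rfl
  · exact T.refl' _
  · exact h s

theorem opSetoid_zero_le_iff (j : Fin 5) {T : Setoid (Bool × Bool)} :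
    opSetoid j 0 ≤ T ↔ ∀ t, T t (opMatch j t) := by
  fin_cases j <;> exact le_iff_of_forall_ker (by decide)

theorem isCoatom_ker_fst : IsCoatom (ker (Prod.fst : Bool × Bool → Bool)) :=
  isCoatom_ker Prod.fst_surjective

theorem isCoatom_ker_snd : IsCoatom (ker (Prod.snd : Bool × Bool → Bool)) :=
  isCoatom_ker Prod.snd_surjective

theorem isCoatom_ker_xor : IsCoatom (ker fun t : Bool × Bool => t.1 ^^ t.2) :=
  isCoatom_ker fun b => ⟨(b, false), Bool.xor_false b⟩

theorem ker_fst_sup_ker_snd :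
    ker (Prod.fst : Bool × Bool → Bool) ⊔ ker (Prod.snd : Bool × Bool → Bool) = ⊤ :=
  isCoatom_ker_fst.sup_eq_top_of_ne isCoatom_ker_snd fun h =>
    absurd (h ▸ rfl : ker Prod.snd (false, false) (false, true)) (by simp [ker_def])

theorem ker_fst_sup_ker_xor :
    ker (Prod.fst : Bool × Bool → Bool) ⊔ (ker fun t : Bool × Bool => t.1 ^^ t.2) = ⊤ :=
  isCoatom_ker_fst.sup_eq_top_of_ne isCoatom_ker_xor fun h =>
    absurd (h ▸ rfl : (ker fun t : Bool × Bool => t.1 ^^ t.2) (false, false) (false, true))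
      (by simp [ker_def])

theorem ker_snd_sup_ker_xor :
    ker (Prod.snd : Bool × Bool → Bool) ⊔ (ker fun t : Bool × Bool => t.1 ^^ t.2) = ⊤ :=
  isCoatom_ker_snd.sup_eq_top_of_ne isCoatom_ker_xor fun h =>
    absurd (h ▸ rfl : (ker fun t : Bool × Bool => t.1 ^^ t.2) (false, false) (true, false))
      (by simp [ker_def])

theorem opSetoid_zero_le_one (j : Fin 5) : opSetoid j 0 ≤ opSetoid j 1 := by
  fin_cases j <;> first | exact le_top | exact le_rfl

theorem opSetoid_zero_le_two (j : Fin 5) : opSetoid j 0 ≤ opSetoid j 2 := by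
  fin_cases j <;> first | exact le_top | exact le_rfl

/-- The way in which the free ends are joined and the relations between the blocks of the partitions
that result from them are one of five possible combinations. -/
theorem exists_eq_opSetoid (s : Fin 3 → Setoid (Bool × Bool))
    (h0 : s 0 = ker Prod.fst ∨ s 0 = (ker fun t => t.1 ^^ t.2) ∨ s 0 = ker Prod.snd)
    (h1 : s 0 ≤ s 1) (h2 : s 0 ≤ s 2) (h1' : ker Prod.fst ≤ s 1)
    (h2' : (ker fun t => t.1 ^^ t.2) ≤ s 2) : ∃ j, ∀ k, s k = opSetoid j k := by
  have htop : ∀ {a b c : Setoid (Bool × Bool)}, a ⊔ b = ⊤ → a ≤ c → b ≤ c → c = ⊤ :=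
    fun h ha hb => top_unique (h ▸ sup_le ha hb)
  -- A pairing that differs from a relation's compulsory one forces that relation to be `⊤`. Where
  -- the two agree, the relation is the pairing itself or `⊤` because the pairing is a coatom. This
  -- gives two, two and one cases.
  rcases h0 with h0 | h0 | h0 <;> rw [h0] at h1 h2
  · have h2 := htop ker_fst_sup_ker_xor h2 h2'
    rcases isCoatom_ker_fst.le_iff.1 h1 with h1 | h1
    · exact ⟨3, by simp [Fin.forall_fin_succ, h0, h1, h2, opSetoid]⟩
    · exact ⟨0, by simp [Fin.forall_fin_succ, h0, h1, h2, opSetoid]⟩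
  · have h1 := htop ker_fst_sup_ker_xor h1' h1
    rcases isCoatom_ker_xor.le_iff.1 h2 with h2 | h2
    · exact ⟨4, by simp [Fin.forall_fin_succ, h0, h1, h2, opSetoid]⟩
    · exact ⟨1, by simp [Fin.forall_fin_succ, h0, h1, h2, opSetoid]⟩
  · have h1 := htop ker_fst_sup_ker_snd h1' h1
    have h2 := htop ker_snd_sup_ker_xor h2 h2'
    exact ⟨2, by simp [Fin.forall_fin_succ, h0, h1, h2, opSetoid]⟩

/-- Exchanging the two arrows preserves equality of first coordinates, of second coordinates and of
their sums mod 2. This is why the tensor product formula does not depend on the couplings. -/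
theorem opSetoid_prodMap (φ : Coupling) (j : Fin 5) (k : Fin 3) (s t : Bool × Bool) :
    opSetoid j k (Prod.map φ id s) (Prod.map φ id t) ↔ opSetoid j k s t := by
  have h1 : (ker (Prod.fst : Bool × Bool → Bool)) (Prod.map φ id s) (Prod.map φ id t) ↔
      (ker (Prod.fst : Bool × Bool → Bool)) s t := by simp [ker_def]
  have h2 : (ker (Prod.snd : Bool × Bool → Bool)) (Prod.map φ id s) (Prod.map φ id t) ↔
      (ker (Prod.snd : Bool × Bool → Bool)) s t := by simp [ker_def]
  have h3 : (ker fun t : Bool × Bool => t.1 ^^ t.2) (Prod.map φ id s) (Prod.map φ id t) ↔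
      (ker fun t : Bool × Bool => t.1 ^^ t.2) s t := by
    have key : ∀ (φ : Bool ≃ Bool) (a b c d : Bool),
        ((φ a ^^ b) = (φ c ^^ d)) ↔ ((a ^^ b) = (c ^^ d)) := by decide
    exact key φ s.1 s.2 t.1 t.2
  have h4 : (⊤ : Setoid (Bool × Bool)) (Prod.map φ id s) (Prod.map φ id t) ↔
      (⊤ : Setoid (Bool × Bool)) s t := Iff.rfl
  fin_cases j <;> fin_cases k <;> first | exact h1 | exact h2 | exact h3 | exact h4

theorem map_opSetoid_coupling {X : Type*} (ι : Bool × Bool → X) (φ : Coupling) (j : Fin 5)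
    (k : Fin 3) : (opSetoid j k).map (fun t => ι (Prod.map φ id t)) = (opSetoid j k).map ι := by
  refine eq_of_forall_ge_iff fun T => ?_
  rw [map_le_iff_le_comap, map_le_iff_le_comap]
  constructor <;> intro h s t hst
  · have := h ((opSetoid_prodMap φ.symm j k s t).2 hst)
    simpa [comap_rel, Prod.map] using this
  · exact h ((opSetoid_prodMap φ j k s t).2 hst)

/-! ### State sums -/

section StateSum

variable {X Y E E' K : Type*} [CommRing K]

/-- The monomial that counts the classes of three equivalence relations. -/
noncomputable def classMonomial (x : Fin 3 → K) (R : Fin 3 → Setoid X) : K :=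
  ∏ k, x k ^ Nat.card (Quotient (R k))

open Classical in
/-- The sum over all ways of resolving all edges, with weight `w e j` for resolving the edge `e` by
the operation `j`. -/
noncomputable def stateSum [Finite E] (x : Fin 3 → K) (w : E → Fin 5 → K) (R : Fin 3 → Setoid X)
    (arrow : E × Bool × Bool → X) : K :=
  letI := Fintype.ofFinite E
  ∑ σ : E → Fin 5, (∏ e, w e (σ e)) *
    classMonomial x fun k => smooth (R k) arrow fun e => opSetoid (σ e) k

theorem stateSum_eq [Fintype E] [DecidableEq E] (x : Fin 3 → K) (w : E → Fin 5 → K)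
    (R : Fin 3 → Setoid X) (arrow : E × Bool × Bool → X) :
    stateSum x w R arrow = ∑ σ : E → Fin 5, (∏ e, w e (σ e)) *
      classMonomial x fun k => smooth (R k) arrow fun e => opSetoid (σ e) k := by
  unfold stateSum
  convert rfl

theorem stateSum_of_isEmpty [Finite E] [IsEmpty E] (x : Fin 3 → K) (w : E → Fin 5 → K)
    (R : Fin 3 → Setoid X) (arrow : E × Bool × Bool → X) :
    stateSum x w R arrow = classMonomial x R := by
  classical
  let := Fintype.ofFinite E
  simp [stateSum_eq, smooth_of_isEmpty]

/-- Sorting the states by the operation chosen at `e` gives the five-term relation in its abstract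
form. -/
theorem stateSum_split [Finite E] (x : Fin 3 → K) (w : E → Fin 5 → K)
    (R : Fin 3 → Setoid X) (arrow : E × Bool × Bool → X) (e : E) :
    stateSum x w R arrow = ∑ j, w e j * stateSum x (fun g : {g // g ≠ e} => w g)
      (fun k => R k ⊔ (opSetoid j k).map fun t => arrow (e, t)) (fun t => arrow (t.1, t.2)) := by
  classical
  let := Fintype.ofFinite E
  simp only [stateSum_eq, Finset.mul_sum]
  rw [← Fintype.sum_prod_type']
  refine Fintype.sum_equiv (Equiv.funSplitAt e (Fin 5)) _ _ fun σ => ?_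
  simp only [Equiv.funSplitAt_apply, ← mul_assoc]
  rw [Fintype.prod_eq_mul_prod_subtype_ne _ e]
  congr 2
  funext k
  exact smooth_split _ _ _ e

/-- The weights of the five operations by which a 2-sum along `κ` can be replaced, where `typ` gives
the way in which the points `κ t` are related in each state. -/
noncomputable def transferWeight [Fintype E] [DecidableEq E] (x : Fin 3 → K) (w : E → Fin 5 → K)
    (S : Fin 3 → Setoid X) (arrow : E × Bool × Bool → X) (κ : Bool × Bool → X)
    (typ : (E → Fin 5) → Fin 5) (j : Fin 5) : K :=
  ∑ τ : E → Fin 5, if typ τ = j then (∏ e, w e (τ e)) *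
    ∏ k, x k ^ Nat.card {c : Quotient (smooth (S k) arrow fun e => opSetoid (τ e) k) //
      ∀ t, c ≠ Quotient.mk _ (κ t)} else 0

theorem sum_mul_transferWeight [Fintype E] [DecidableEq E] (x : Fin 3 → K) (w : E → Fin 5 → K)
    (S : Fin 3 → Setoid X) (arrow : E × Bool × Bool → X) (κ : Bool × Bool → X)
    (typ : (E → Fin 5) → Fin 5) (a : Fin 5 → K) :
    ∑ j, a j * transferWeight x w S arrow κ typ j =
      ∑ τ : E → Fin 5, (∏ e, w e (τ e)) * (a (typ τ) *
        ∏ k, x k ^ Nat.card {c : Quotient (smooth (S k) arrow fun e => opSetoid (τ e) k) //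
          ∀ t, c ≠ Quotient.mk _ (κ t)}) := by
  simp only [transferWeight, Finset.mul_sum]
  rw [Finset.sum_comm]
  refine Finset.sum_congr rfl fun τ _ => ?_
  rw [Finset.sum_eq_single (typ τ) (fun j _ hj => by rw [if_neg hj.symm, mul_zero]) (by simp),
    if_pos rfl, mul_left_comm]

/-- By `card_glueAlong`, the exponents of a combined state split into the classes on the `X` side,
after the identifications of type `typ τ`, and the classes on the `Y` side that avoid `κ`. Only the
first part involves the state on `X`, so the states on `Y` can be summed by type. -/
theorem stateSum_glueAlong [Finite E] [Fintype E'] [DecidableEq E'] [Finite X] [Finite Y]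
    (x : Fin 3 → K) (w : E → Fin 5 → K) (w' : E' → Fin 5 → K) (R : Fin 3 → Setoid X)
    (S : Fin 3 → Setoid Y) (arrow : E × Bool × Bool → X) (arrow' : E' × Bool × Bool → Y)
    (ι : Bool × Bool → X) (κ : Bool × Bool → Y) (typ : (E' → Fin 5) → Fin 5)
    (htyp : ∀ τ k, (smooth (S k) arrow' fun e => opSetoid (τ e) k).comap κ =
      opSetoid (typ τ) k) :
    stateSum x (Sum.elim w w') (fun k => glueAlong ι κ (R k) (S k))
      (fun t => Sum.elim (fun g => Sum.inl (arrow (g, t.2))) (fun h => Sum.inr (arrow' (h, t.2)))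
        t.1) =
      ∑ j, transferWeight x w' S arrow' κ typ j *
        stateSum x w (fun k => R k ⊔ (opSetoid j k).map ι) arrow := by
  classical
  let := Fintype.ofFinite E
  simp only [mul_comm (transferWeight _ _ _ _ _ _ _)]
  rw [sum_mul_transferWeight]
  simp only [stateSum_eq, Finset.sum_mul, Finset.mul_sum]
  rw [← Fintype.sum_prod_type_right']
  refine Fintype.sum_equiv (Equiv.sumArrowEquivProdArrow E E' (Fin 5)) _ _ fun σ => ?_
  simp only [Fintype.prod_sum_type, Sum.elim_inl, Sum.elim_inr, classMonomial, smooth_glueAlong,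
    card_glueAlong, pow_add, Finset.prod_mul_distrib, smooth_sup]
  have h := fun k => htyp (fun e => σ (.inr e)) k
  simp only [h]
  simp only [Equiv.sumArrowEquivProdArrow, Equiv.coe_fn_mk, Function.comp_def]
  ring

/-- The number of classes, recorded by `x`, that result on the ends of the arrows of an edge when
its ends are joined by operation `j` on one side and by operation `i` on the other. -/
noncomputable def pairing (x : Fin 3 → K) (i j : Fin 5) : K :=
  ∏ k, x k ^ Nat.card (Quotient (opSetoid i k ⊔ opSetoid j k))

/-- The classes meeting `κ` are counted on the four ends alone by `card_sup_map`, and give the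
factor `pairing x i (typ τ)`. The other classes do not depend on `i`, so the same weights as in
`stateSum_glueAlong` occur here. -/
theorem stateSum_sup_map [Fintype E] [DecidableEq E] [Finite X]
    (x : Fin 3 → K) (w : E → Fin 5 → K) (S : Fin 3 → Setoid X) (arrow : E × Bool × Bool → X)
    (κ : Bool × Bool → X) (typ : (E → Fin 5) → Fin 5)
    (htyp : ∀ τ k, (smooth (S k) arrow fun e => opSetoid (τ e) k).comap κ = opSetoid (typ τ) k)
    (i : Fin 5) :
    stateSum x w (fun k => S k ⊔ (opSetoid i k).map κ) arrow =
      ∑ j, pairing x i j * transferWeight x w S arrow κ typ j := by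
  rw [sum_mul_transferWeight, stateSum_eq]
  refine Finset.sum_congr rfl fun τ _ => ?_
  simp only [classMonomial, smooth_sup, card_sup_map, htyp, pow_add, Finset.prod_mul_distrib,
    pairing]

/-- Each of the three pairings has two classes and the join of two different ones has one. The
exponent of each variable is therefore `1` or `2`; the common `1` is the scalar in front. -/
theorem pairing_eq (x : Fin 3 → K) (i j : Fin 5) : pairing x i j =
    ((x 0 * x 1 * x 2) •
      !![x 0 * x 1, 1, 1, x 0, 1;
         1, x 0 * x 2, 1, 1, x 0;
         1, 1, x 0, 1, 1;
         x 0, 1, 1, x 0, 1;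
         1, x 0, 1, 1, x 0]) i j := by
  have c1 : Nat.card (Quotient (ker (Prod.fst : Bool × Bool → Bool))) = 2 := by
    rw [card_quotient_ker _ Prod.fst_surjective]; simp
  have c2 : Nat.card (Quotient (ker (Prod.snd : Bool × Bool → Bool))) = 2 := by
    rw [card_quotient_ker _ Prod.snd_surjective]; simp
  have c3 : Nat.card (Quotient (ker fun t : Bool × Bool => t.1 ^^ t.2)) = 2 := by
    rw [card_quotient_ker _ fun b => ⟨(b, false), Bool.xor_false b⟩]; simp
  have s1 := ker_fst_sup_ker_snd
  have s2 := ker_fst_sup_ker_xor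
  have s3 := ker_snd_sup_ker_xor
  have s1' := sup_comm (ker Prod.fst) _ ▸ s1
  have s2' := sup_comm (ker Prod.fst) _ ▸ s2
  have s3' := sup_comm (ker Prod.snd) _ ▸ s3
  fin_cases i <;> fin_cases j <;>
    simp [pairing, opSetoid, Fin.prod_univ_three, c1, c2, c3, s1, s2, s3, s1', s2', s3'] <;>
    ring

end StateSum

end ArrowPresentation

/-! ### State sums of packaged arrow presentations -/

namespace ArrowPresentation

open Setoid

/-- Two points are equivalent iff they lie on the same component of what remains of the circles when
the arcs that carry arrows are removed. -/
def freeSetoid (G : ArrowPresentation.{u}) : Setoid G.Pt :=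
  Relation.EqvGen.setoid fun p q => q = G.outer p ∨ (p ∉ Set.range G.arrow ∧ q = G.inner p)

theorem freeSetoid_le_iff (G : ArrowPresentation.{u}) {T : Setoid G.Pt} :
    G.freeSetoid ≤ T ↔
      (∀ p, T p (G.outer p)) ∧ ∀ p, p ∉ Set.range G.arrow → T p (G.inner p) := by
  refine eqvGen_setoid_le_iff.trans ⟨fun h => ⟨fun p => h _ _ (.inl rfl), fun p hp =>
    h _ _ (.inr ⟨hp, rfl⟩)⟩, ?_⟩
  rintro ⟨h1, h2⟩ p _ (rfl | ⟨hp, rfl⟩)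
  · exact h1 p
  · exact h2 p hp

theorem freeSetoid_le_vertexSetoid (G : ArrowPresentation.{u}) :
    G.freeSetoid ≤ G.vertexSetoid :=
  G.freeSetoid_le_iff.2 ⟨fun _ => Relation.EqvGen.rel _ _ (.inl rfl),
    fun _ _ => Relation.EqvGen.rel _ _ (.inr rfl)⟩

theorem freeSetoid_le_boundarySetoid (G : ArrowPresentation.{u}) :
    G.freeSetoid ≤ G.boundarySetoid :=
  G.freeSetoid_le_iff.2 ⟨fun _ => Relation.EqvGen.rel _ _ (.inl rfl),
    fun _ hp => Relation.EqvGen.rel _ _ (.inr (.inl ⟨hp, rfl⟩))⟩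

/-- Free components may replace the circles as initial data: resolving edges only joins free
components, and once no edge is left they are the circles. -/
theorem vertexSetoid_of_isEmpty (G : ArrowPresentation.{u}) [IsEmpty G.Edge] :
    G.vertexSetoid = G.freeSetoid := by
  refine le_antisymm (eqvGen_setoid_le_iff.2 ?_) G.freeSetoid_le_vertexSetoid
  rintro p _ (rfl | rfl)
  · exact Relation.EqvGen.rel _ _ (.inl rfl)
  · exact Relation.EqvGen.rel _ _ (.inr ⟨fun ⟨t, _⟩ => isEmptyElim t.1, rfl⟩)

theorem freeSetoid_resolve (G : ArrowPresentation.{u}) (e : G.Edge)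
    (m : Bool × Bool → Bool × Bool) (hm : ∀ t, m (m t) = t) (hm' : ∀ t, m t ≠ t)
    (s : Setoid (Bool × Bool)) (hs : ∀ T : Setoid (Bool × Bool), s ≤ T ↔ ∀ t, T t (m t)) :
    ((G.resolve e m hm hm').freeSetoid : Setoid G.Pt) =
      G.freeSetoid ⊔ s.map fun t => G.arrow (e, t) := by
  refine eq_of_forall_ge_iff (α := Setoid G.Pt) fun T => ?_
  refine (freeSetoid_le_iff (G.resolve e m hm hm')).trans ?_
  change (∀ p : G.Pt, T p (G.outer p)) ∧
    (∀ p : G.Pt, p ∉ Set.range (G.resolve e m hm hm').arrow → T p (G.rewire e m p)) ↔ _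
  rw [sup_le_iff, map_le_iff_le_comap, hs, freeSetoid_le_iff, and_assoc]
  refine and_congr_right fun _ => ?_
  constructor
  · refine fun h => ⟨fun p hp => ?_, fun t => ?_⟩
    · have := h p fun ⟨t, ht⟩ => hp ⟨(t.1.1, t.2), ht⟩
      rwa [rewire_of_not _ _ _ _ fun ⟨t, ht⟩ => hp ⟨_, ht⟩] at this
    · have := h (G.arrow (e, t)) fun ⟨g, hg⟩ => g.1.2 (congrArg Prod.fst (G.arrow_injective hg))
      rwa [rewire_arrow] at this
  · rintro ⟨h1, h2⟩ p hp
    by_cases h : ∃ t, G.arrow (e, t) = p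
    · obtain ⟨t, rfl⟩ := h
      rw [rewire_arrow]
      exact h2 t
    · rw [rewire_of_not _ _ _ _ h]
      refine h1 p ?_
      rintro ⟨⟨g, t⟩, rfl⟩
      exact hp ⟨(⟨g, fun hg => h ⟨t, hg ▸ rfl⟩⟩, t), rfl⟩

/-- The gluing is indexed by the ends at `e`, which puts the coupling on the side of `G`, where
`map_opSetoid_coupling` removes it. -/
theorem glue_eq_glueAlong (G H : ArrowPresentation.{u}) (f : G.Edge) (e : H.Edge) (φ : Coupling)
    (R : Setoid G.Pt) (S : Setoid H.Pt) : G.glue H f e φ R S =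
      glueAlong (fun t => G.arrow (f, Prod.map φ.symm id t)) (fun t => H.arrow (e, t)) R S := by
  refine eq_of_forall_ge_iff fun T => ?_
  rw [glueAlong_le_iff]
  constructor
  · refine fun h => ⟨fun x y hxy => h (glue_inl _ _ _ _ _ _ _ hxy),
      fun x y hxy => h (glue_inr _ _ _ _ _ _ _ hxy), fun t => ?_⟩
    have := h (glue_link G H f e φ R S (φ.symm t.1) t.2)
    rwa [Equiv.apply_symm_apply] at this
  · rintro ⟨h1, h2, h3⟩
    refine eqvGen_setoid_le_iff.2 ?_
    rintro _ _ (⟨h | h⟩ | ⟨i, b, rfl, rfl⟩)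
    · exact h1 (by assumption)
    · exact h2 (by assumption)
    · simpa using h3 (φ i, b)

theorem freeSetoid_twoSum (G H : ArrowPresentation.{u}) (f : G.Edge) (e : H.Edge) (φ : Coupling) :
    (G.twoSum H f e φ).freeSetoid = G.glue H f e φ G.freeSetoid H.freeSetoid := by
  rw [glue_eq_glueAlong]
  refine eq_of_forall_ge_iff (α := Setoid (G.Pt ⊕ H.Pt)) fun T => ?_
  refine (freeSetoid_le_iff (G.twoSum H f e φ)).trans ?_
  change (∀ p : G.Pt ⊕ H.Pt, T p (Sum.map G.outer H.outer p)) ∧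
    (∀ p : G.Pt ⊕ H.Pt, p ∉ Set.range (G.twoSum H f e φ).arrow →
      T p ((G.twoSum H f e φ).inner p)) ↔ _
  rw [glueAlong_le_iff, freeSetoid_le_iff, freeSetoid_le_iff]
  constructor
  · rintro ⟨h1, h2⟩
    refine ⟨⟨fun p => h1 (.inl p), fun p hp => ?_⟩, ⟨fun p => h1 (.inr p), fun p hp => ?_⟩,
      fun t => ?_⟩
    · have : T (.inl p) (G.crossing H f e φ p) := h2 (.inl p) (by
        rintro ⟨⟨g | g, t⟩, ht⟩
        · exact hp ⟨_, Sum.inl_injective ht⟩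
        · cases ht)
      rwa [crossing_of_not _ _ _ _ _ _ fun ⟨t, ht⟩ => hp ⟨_, ht⟩] at this
    · have : T (.inr p) (H.crossing G e f φ.symm p).swap := h2 (.inr p) (by
        rintro ⟨⟨g | g, t⟩, ht⟩
        · cases ht
        · exact hp ⟨_, Sum.inr_injective ht⟩)
      rwa [crossing_of_not _ _ _ _ _ _ fun ⟨t, ht⟩ => hp ⟨_, ht⟩] at this
    · have : T (.inl (G.arrow (f, φ.symm t.1, t.2)))
          (G.crossing H f e φ (G.arrow (f, φ.symm t.1, t.2))) := h2 (.inl _) (by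
        rintro ⟨⟨g | g, t⟩, ht⟩
        · exact g.2 (congrArg Prod.fst (G.arrow_injective (Sum.inl_injective ht)))
        · cases ht)
      rwa [crossing_arrow, Equiv.apply_symm_apply] at this
  · rintro ⟨⟨h1, h2⟩, ⟨h3, h4⟩, h5⟩
    refine ⟨?_, ?_⟩
    · rintro (p | p)
      · exact h1 p
      · exact h3 p
    · rintro (p | p) hp
      · change T (.inl p) (G.crossing H f e φ p)
        by_cases h : ∃ t, G.arrow (f, t) = p
        · obtain ⟨⟨i, b⟩, rfl⟩ := h
          rw [crossing_arrow]
          simpa using h5 (φ i, b)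
        · rw [crossing_of_not _ _ _ _ _ _ h]
          refine h2 p ?_
          rintro ⟨⟨g, t⟩, rfl⟩
          exact hp ⟨(.inl ⟨g, fun hg => h ⟨t, hg ▸ rfl⟩⟩, t), rfl⟩
      · change T (.inr p) (H.crossing G e f φ.symm p).swap
        by_cases h : ∃ t, H.arrow (e, t) = p
        · obtain ⟨⟨i, b⟩, rfl⟩ := h
          rw [crossing_arrow]
          exact T.symm' (h5 (i, b))
        · rw [crossing_of_not _ _ _ _ _ _ h]
          refine h4 p ?_
          rintro ⟨⟨g, t⟩, rfl⟩
          exact hp ⟨(.inr ⟨g, fun hg => h ⟨t, hg ▸ rfl⟩⟩, t), rfl⟩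

/-! ### The pairing of the free ends when all edges but one are resolved. -/

open Classical in
/-- The inner arcs after the ends of the arrows of every edge `g` have been joined according
to `μ g`. -/
noncomputable def rewireAll (G : ArrowPresentation.{u}) (μ : G.Edge → Bool × Bool → Bool × Bool)
    (p : G.Pt) : G.Pt :=
  if h : ∃ t, G.arrow t = p then G.arrow (h.choose.1, μ h.choose.1 h.choose.2) else G.inner p

theorem rewireAll_arrow (G : ArrowPresentation.{u}) (μ : G.Edge → Bool × Bool → Bool × Bool)
    (g : G.Edge) (t : Bool × Bool) :
    G.rewireAll μ (G.arrow (g, t)) = G.arrow (g, μ g t) := by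
  have h : ∃ s, G.arrow s = G.arrow (g, t) := ⟨_, rfl⟩
  rw [rewireAll, dif_pos h, G.arrow_injective h.choose_spec]

theorem rewireAll_of_not (G : ArrowPresentation.{u}) (μ : G.Edge → Bool × Bool → Bool × Bool)
    (p : G.Pt) (h : p ∉ Set.range G.arrow) : G.rewireAll μ p = G.inner p := by
  exact dif_neg h

theorem rewireAll_involutive (G : ArrowPresentation.{u})
    (μ : G.Edge → Bool × Bool → Bool × Bool) (hμ : ∀ g, Function.Involutive (μ g)) :
    Function.Involutive (G.rewireAll μ) := by
  intro p
  by_cases h : p ∈ Set.range G.arrow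
  · obtain ⟨⟨g, t⟩, rfl⟩ := h
    rw [rewireAll_arrow, rewireAll_arrow, hμ g t]
  · have h' : G.inner p ∉ Set.range G.arrow := by
      rintro ⟨⟨g, t⟩, ht⟩
      exact G.inner_not g p (fun ⟨s, hs⟩ => h ⟨_, hs⟩) ⟨t, ht⟩
    rw [rewireAll_of_not _ _ _ h, rewireAll_of_not _ _ _ h', G.inner_inner]

/-- If all edges except `e` are resolved, then the free ends at the arrows of `e` are joined in pairs
in one of three ways. -/
theorem comap_smooth_freeSetoid (G : ArrowPresentation.{u}) (e : G.Edge)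
    (τ : {g // g ≠ e} → Fin 5) :
    let s := (smooth G.freeSetoid (fun t : {g // g ≠ e} × Bool × Bool => G.arrow (t.1, t.2))
      fun g => opSetoid (τ g) 0).comap fun t => G.arrow (e, t)
    s = ker Prod.fst ∨ s = (ker fun t => t.1 ^^ t.2) ∨ s = ker Prod.snd := by
  classical
  intro s
  have := G.finite_pt
  -- The identity at `e` makes the four ends at `e` the fixed points of `rewireAll`, that is, the
  -- free ends in `exists_unique_other_end`.
  let μ : G.Edge → Bool × Bool → Bool × Bool :=
    fun g => if h : g = e then id else opMatch (τ ⟨g, h⟩)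
  have hμe : μ e = id := by simp [μ]
  have hμ : ∀ g (h : g ≠ e), μ g = opMatch (τ ⟨g, h⟩) := fun g h => by simp [μ, h]
  have hinv : ∀ g, Function.Involutive (μ g) := by
    intro g
    by_cases h : g = e
    · rw [h, hμe]; exact fun _ => rfl
    · rw [hμ g h]; exact opMatch_opMatch _
  have hfix : ∀ t, G.rewireAll μ (G.arrow (e, t)) = G.arrow (e, t) := by
    intro t
    rw [rewireAll_arrow, hμe, id]
  have hfix' : ∀ p, G.rewireAll μ p = p → ∃ t, p = G.arrow (e, t) := by
    intro p hp
    by_cases h : p ∈ Set.range G.arrow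
    · obtain ⟨⟨g, t⟩, rfl⟩ := h
      by_cases hg : g = e
      · exact ⟨t, hg ▸ rfl⟩
      · rw [rewireAll_arrow, hμ g hg] at hp
        exact absurd (congrArg Prod.snd (G.arrow_injective hp)) (opMatch_ne _ t)
    · rw [rewireAll_of_not _ _ _ h] at hp
      exact absurd hp (G.inner_ne p)
  have hsmooth : smooth G.freeSetoid
      (fun t : {g // g ≠ e} × Bool × Bool => G.arrow (t.1, t.2)) (fun g => opSetoid (τ g) 0) =
      Relation.EqvGen.setoid fun p q => q = G.outer p ∨ q = G.rewireAll μ p := by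
    refine eq_of_forall_ge_iff fun T => ?_
    rw [smooth_le_iff, freeSetoid_le_iff, eqvGen_setoid_le_iff]
    simp only [opSetoid_zero_le_iff, comap_rel]
    constructor
    · rintro ⟨⟨h1, h2⟩, h3⟩ p _ (rfl | rfl)
      · exact h1 p
      · by_cases h : p ∈ Set.range G.arrow
        · obtain ⟨⟨g, t⟩, rfl⟩ := h
          by_cases hg : g = e
          · rw [hg, hfix]
          · rw [rewireAll_arrow, hμ g hg]
            exact h3 ⟨g, hg⟩ t
        · rw [rewireAll_of_not _ _ _ h]
          exact h2 p h
    · intro h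
      refine ⟨⟨fun p => h _ _ (.inl rfl), fun p hp => ?_⟩, fun g t => ?_⟩
      · exact h _ _ (.inr (rewireAll_of_not _ _ _ hp).symm)
      · refine h _ _ (.inr ?_)
        rw [rewireAll_arrow, hμ g g.2]
  have hs : ∀ t u, s t u ↔ Relation.EqvGen.setoid
      (fun p q => q = G.outer p ∨ q = G.rewireAll μ p) (G.arrow (e, t)) (G.arrow (e, u)) :=
    fun t u => by rw [← hsmooth]; rfl
  have hpartner : ∀ t, ∃ t', t' ≠ t ∧ ∀ u, s t u ↔ u = t ∨ u = t' := by
    intro t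
    obtain ⟨y, hy, hyfix, hxy, huniq⟩ := exists_unique_other_end G.outer_outer G.outer_ne
      (G.rewireAll_involutive μ hinv) (G.arrow (e, t)) (hfix t)
    obtain ⟨t', rfl⟩ := hfix' y hyfix
    refine ⟨t', fun h => hy (h ▸ rfl), fun u => ?_⟩
    rw [hs]
    constructor
    · intro h
      refine (huniq _ (hfix u) h).imp ?_ ?_ <;>
        exact fun h => congrArg Prod.snd (G.arrow_injective h)
    · rintro (rfl | rfl)
      · exact Setoid.refl' _ _
      · exact hxy
  choose p hp hsp using hpartner
  have hpp : ∀ t, p (p t) = t := by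
    intro t
    have h := (hsp (p t) t).1 (s.symm' ((hsp t _).2 (.inr rfl)))
    exact (h.resolve_left (hp t).symm).symm
  have hp_cases : p = (fun t => (t.1, !t.2)) ∨ p = (fun t => (!t.1, !t.2)) ∨
      p = fun t => (!t.1, t.2) := by
    -- A fixed-point-free involution of four points is one of three. Listing its four values reduces
    -- this to a finite check.
    have key : ∀ a b c d : Bool × Bool, a ≠ (false, false) → b ≠ (false, true) →
        c ≠ (true, false) → d ≠ (true, true) → ∀ q : Bool × Bool → Bool × Bool,
        q = (fun t => bif t.1 then (bif t.2 then d else c) else (bif t.2 then b else a)) →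
        (q a = (false, false) ∧ q b = (false, true) ∧ q c = (true, false) ∧ q d = (true, true)) →
        (∀ t, q t = (t.1, !t.2)) ∨ (∀ t, q t = (!t.1, !t.2)) ∨ ∀ t, q t = (!t.1, t.2) := by
      intro a b c d ha hb hc hd q hq
      subst hq
      revert a b c d
      decide
    have := key (p (false, false)) (p (false, true)) (p (true, false)) (p (true, true))
      (hp _) (hp _) (hp _) (hp _) p (by funext ⟨i, b⟩; cases i <;> cases b <;> rfl)
      ⟨hpp _, hpp _, hpp _, hpp _⟩
    simpa only [funext_iff] using this
  have hker : ∀ {f : Bool × Bool → Bool}, (∀ t u, (u = t ∨ u = p t) ↔ f t = f u) → s = ker f :=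
    fun h => Setoid.ext fun t u => (hsp t u).trans (h t u)
  rcases hp_cases with rfl | rfl | rfl
  · exact .inl (hker (by decide))
  · exact .inr (.inl (hker (by decide)))
  · exact .inr (.inr (hker (by decide)))

end ArrowPresentation

namespace PackagedArrowPresentation

open ArrowPresentation Setoid

instance (G : PackagedArrowPresentation.{u}) : Finite G.Edge := G.finite_edge

instance (G : PackagedArrowPresentation.{u}) : Finite G.Pt := G.finite_pt

/-- The free components of the circles, the vertex partition and the boundary partition. -/
def base (G : PackagedArrowPresentation.{u}) : Fin 3 → Setoid G.Pt :=
  ![G.freeSetoid, G.vertexPartition, G.boundaryPartition]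

theorem ker_fst_le_vertexPartition (G : PackagedArrowPresentation.{u}) (e : G.Edge) :
    ker Prod.fst ≤ G.vertexPartition.comap fun t => G.arrow (e, t) :=
  (opSetoid_zero_le_iff 0).2 fun t => G.vertex_inner e t.1 t.2 _

theorem ker_xor_le_boundaryPartition (G : PackagedArrowPresentation.{u}) (e : G.Edge) :
    (ker fun t => t.1 ^^ t.2) ≤ G.boundaryPartition.comap fun t => G.arrow (e, t) :=
  (opSetoid_zero_le_iff 1).2 fun t => G.boundary_cross e t.1 t.2

/-- Deletion leaves the vertex partition unchanged, and this still is a join with `opSetoid 0 1`,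
because the ends of an arrow already lie in one class. `boundaryPartition_sup` plays this role for
contraction, so all five operations take a uniform form. -/
theorem vertexPartition_sup (G : PackagedArrowPresentation.{u}) (e : G.Edge) :
    G.vertexPartition ⊔ (ker Prod.fst).map (fun t => G.arrow (e, t)) = G.vertexPartition :=
  sup_eq_left.2 (map_le_iff_le_comap.2 (G.ker_fst_le_vertexPartition e))

theorem boundaryPartition_sup (G : PackagedArrowPresentation.{u}) (e : G.Edge) :
    G.boundaryPartition ⊔ (ker fun t => t.1 ^^ t.2).map (fun t => G.arrow (e, t)) =
      G.boundaryPartition :=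
  sup_eq_left.2 (map_le_iff_le_comap.2 (G.ker_xor_le_boundaryPartition e))

theorem mergedVertices_eq (G : PackagedArrowPresentation.{u}) (e : G.Edge) :
    G.mergedVertices e =
      G.vertexPartition ⊔ (⊤ : Setoid (Bool × Bool)).map fun t => G.arrow (e, t) := by
  refine le_antisymm (sup_le_sup_left (eqvGen_setoid_le_iff.2 ?_) _)
    (sup_le (le_mergeClasses _ _ _) (map_le_iff_le_comap.2 fun s t _ => G.mergedVertices_all e s t))
  rintro _ _ ⟨rfl, rfl⟩
  exact le_comap_map (r := ⊤) (f := fun t => G.arrow (e, t)) trivial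

theorem mergedBoundary_eq (G : PackagedArrowPresentation.{u}) (e : G.Edge) :
    G.mergedBoundary e =
      G.boundaryPartition ⊔ (⊤ : Setoid (Bool × Bool)).map fun t => G.arrow (e, t) := by
  refine le_antisymm (sup_le_sup_left (eqvGen_setoid_le_iff.2 ?_) _)
    (sup_le (le_mergeClasses _ _ _) (map_le_iff_le_comap.2 fun s t _ => G.mergedBoundary_all e s t))
  rintro _ _ ⟨rfl, rfl⟩
  exact le_comap_map (r := ⊤) (f := fun t => G.arrow (e, t)) trivial

theorem freeSetoid_op (G : PackagedArrowPresentation.{u}) (e : G.Edge) (j : Fin 5) :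
    ((G.resolve e (opMatch j) (opMatch_opMatch j) (opMatch_ne j)).freeSetoid : Setoid G.Pt) =
      G.freeSetoid ⊔ (opSetoid j 0).map fun t => G.arrow (e, t) :=
  freeSetoid_resolve _ _ _ _ _ _ fun _ => opSetoid_zero_le_iff j

variable {K : Type*} [CommRing K]

/-- The state sum of a packaged arrow presentation. -/
noncomputable def stateSum (x : Fin 3 → K) (G : PackagedArrowPresentation.{u})
    (w : G.Edge → Fin 5 → K) : K :=
  ArrowPresentation.stateSum x w G.base G.arrow

theorem stateSum_eq_of_base (x : Fin 3 → K) (G : PackagedArrowPresentation.{u}) (e : G.Edge)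
    (w : {g // g ≠ e} → Fin 5 → K) (j : Fin 5) {R : Fin 3 → Setoid G.Pt}
    (h0 : R 0 = G.freeSetoid ⊔ (opSetoid j 0).map fun t => G.arrow (e, t))
    (h1 : R 1 = G.vertexPartition ⊔ (opSetoid j 1).map fun t => G.arrow (e, t))
    (h2 : R 2 = G.boundaryPartition ⊔ (opSetoid j 2).map fun t => G.arrow (e, t)) :
    ArrowPresentation.stateSum x w R (fun t => G.arrow (t.1, t.2)) =
      ArrowPresentation.stateSum x w
        (fun k => G.base k ⊔ (opSetoid j k).map fun t => G.arrow (e, t))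
        (fun t => G.arrow (t.1, t.2)) := by
  congr 1
  funext k
  fin_cases k
  · exact h0
  · exact h1
  · exact h2

theorem stateSum_delete (x : Fin 3 → K) (G : PackagedArrowPresentation.{u}) (e : G.Edge)
    (w : {g // g ≠ e} → Fin 5 → K) : stateSum x (G.delete e) w =
      ArrowPresentation.stateSum x w
        (fun k => G.base k ⊔ (opSetoid 0 k).map fun t => G.arrow (e, t))
        (fun t => G.arrow (t.1, t.2)) :=
  stateSum_eq_of_base x G e w 0 (R := (G.delete e).base) (G.freeSetoid_op e 0)
    (G.vertexPartition_sup e).symm (G.mergedBoundary_eq e)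

theorem stateSum_contract (x : Fin 3 → K) (G : PackagedArrowPresentation.{u}) (e : G.Edge)
    (w : {g // g ≠ e} → Fin 5 → K) : stateSum x (G.contract e) w =
      ArrowPresentation.stateSum x w
        (fun k => G.base k ⊔ (opSetoid 1 k).map fun t => G.arrow (e, t))
        (fun t => G.arrow (t.1, t.2)) :=
  stateSum_eq_of_base x G e w 1 (R := (G.contract e).base) (G.freeSetoid_op e 1)
    (G.mergedVertices_eq e) (G.boundaryPartition_sup e).symm

theorem stateSum_penrose (x : Fin 3 → K) (G : PackagedArrowPresentation.{u}) (e : G.Edge)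
    (w : {g // g ≠ e} → Fin 5 → K) : stateSum x (G.penrose e) w =
      ArrowPresentation.stateSum x w
        (fun k => G.base k ⊔ (opSetoid 2 k).map fun t => G.arrow (e, t))
        (fun t => G.arrow (t.1, t.2)) :=
  stateSum_eq_of_base x G e w 2 (R := (G.penrose e).base) (G.freeSetoid_op e 2)
    (G.mergedVertices_eq e) (G.mergedBoundary_eq e)

theorem stateSum_mergeDelete (x : Fin 3 → K) (G : PackagedArrowPresentation.{u}) (e : G.Edge)
    (w : {g // g ≠ e} → Fin 5 → K) : stateSum x (G.mergeDelete e) w =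
      ArrowPresentation.stateSum x w
        (fun k => G.base k ⊔ (opSetoid 3 k).map fun t => G.arrow (e, t))
        (fun t => G.arrow (t.1, t.2)) :=
  stateSum_eq_of_base x G e w 3 (R := (G.mergeDelete e).base) (G.freeSetoid_op e 3)
    (G.mergedVertices_eq e) (G.mergedBoundary_eq e)

theorem stateSum_mergeContract (x : Fin 3 → K) (G : PackagedArrowPresentation.{u}) (e : G.Edge)
    (w : {g // g ≠ e} → Fin 5 → K) : stateSum x (G.mergeContract e) w =
      ArrowPresentation.stateSum x w
        (fun k => G.base k ⊔ (opSetoid 4 k).map fun t => G.arrow (e, t))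
        (fun t => G.arrow (t.1, t.2)) :=
  stateSum_eq_of_base x G e w 4 (R := (G.mergeContract e).base) (G.freeSetoid_op e 4)
    (G.mergedVertices_eq e) (G.mergedBoundary_eq e)

/-! ### Maps that satisfy a five-term relation -/

/-- The five-term relation with coefficients `v`, and the values on edgeless packaged arrow
presentations given by `x`. -/
def IsFiveTerm (x : Fin 3 → K) (v : Fin 5 → K) (f : PackagedArrowPresentation.{u} → K) : Prop :=
  (∀ (G : PackagedArrowPresentation.{u}) (e : G.Edge),
    f G = v 0 * f (G.delete e) + v 1 * f (G.contract e) + v 2 * f (G.penrose e) +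
      v 3 * f (G.mergeDelete e) + v 4 * f (G.mergeContract e)) ∧
  ∀ G : PackagedArrowPresentation.{u}, IsEmpty G.Edge →
    f G = x 0 ^ G.numVertices * x 1 ^ G.numVertexClasses * x 2 ^ G.numBoundaryClasses

theorem isFiveTerm_stateSum (x : Fin 3 → K) (v : Fin 5 → K) :
    IsFiveTerm.{u} x v fun G => stateSum x G fun _ => v := by
  constructor
  · intro G e
    refine (stateSum_split x (fun _ => v) G.base G.arrow e).trans ?_
    rw [Fin.sum_univ_five]
    exact congr (congrArg _ (congr (congrArg _ (congr (congrArg _ (congr (congrArg _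
      (congrArg _ (stateSum_delete x G e fun _ => v).symm))
      (congrArg _ (stateSum_contract x G e fun _ => v).symm)))
      (congrArg _ (stateSum_penrose x G e fun _ => v).symm)))
      (congrArg _ (stateSum_mergeDelete x G e fun _ => v).symm)))
      (congrArg _ (stateSum_mergeContract x G e fun _ => v).symm)
  · intro G hG
    refine (stateSum_of_isEmpty x _ _ _).trans ?_
    rw [classMonomial, Fin.prod_univ_three, numVertices, Vertex, vertexSetoid_of_isEmpty]
    rfl

theorem IsFiveTerm.unique {x : Fin 3 → K} {v : Fin 5 → K}
    {f g : PackagedArrowPresentation.{u} → K} (hf : IsFiveTerm x v f) (hg : IsFiveTerm x v g) :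
    f = g := by
  classical
  have key : ∀ (n : ℕ) (G : PackagedArrowPresentation.{u}), Nat.card G.Edge = n → f G = g G := by
    intro n
    induction n with
    | zero =>
      intro G hG
      have := Finite.card_eq_zero_iff.1 hG
      rw [hf.2 G this, hg.2 G this]
    | succ n ih =>
      intro G hG
      obtain ⟨e⟩ := Finite.card_pos_iff.1 (show 0 < Nat.card G.Edge by omega)
      have hcard : Nat.card {g : G.Edge // g ≠ e} = n := by
        have h := Nat.card_congr (Equiv.optionSubtypeNe e)
        rw [Finite.card_option, hG] at h
        omega
      rw [hf.1 G e, hg.1 G e, ih (G.delete e) hcard, ih (G.contract e) hcard,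
        ih (G.penrose e) hcard, ih (G.mergeDelete e) hcard, ih (G.mergeContract e) hcard]
  exact funext fun G => key _ G rfl

theorem IsFiveTerm.eq_stateSum {x : Fin 3 → K} {v : Fin 5 → K}
    {f : PackagedArrowPresentation.{u} → K} (hf : IsFiveTerm x v f)
    (G : PackagedArrowPresentation.{u}) : f G = stateSum x G fun _ => v :=
  congrFun (hf.unique (isFiveTerm_stateSum x v)) G

/-- This moves `Z` into the field of fractions and evaluates `Q` at the solution of the system, so
that both become state sums over one field. -/
theorem IsFiveTerm.map {L : Type*} [CommRing L] {x : Fin 3 → K} {v : Fin 5 → K}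
    {f : PackagedArrowPresentation.{u} → K} (hf : IsFiveTerm x v f) (θ : K →+* L) :
    IsFiveTerm (fun k => θ (x k)) (fun j => θ (v j)) fun G => θ (f G) := by
  refine ⟨fun G e => ?_, fun G hG => ?_⟩
  · refine (congrArg θ (hf.1 G e)).trans ?_
    simp only [map_add, map_mul]
  · refine (congrArg θ (hf.2 G hG)).trans ?_
    simp only [map_mul, map_pow]

/-! ### 2-sums and tensor products -/

/-- If all edges except `e` are resolved, then the ends of the arrows of `e` are related in one of
five ways. -/
theorem exists_type (H : PackagedArrowPresentation.{u}) (e : H.Edge) (τ : {g // g ≠ e} → Fin 5) :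
    ∃ j, ∀ k, (smooth (H.base k)
      (fun t : {g // g ≠ e} × Bool × Bool => H.arrow (t.1, t.2))
      fun g => opSetoid (τ g) k).comap (fun t => H.arrow (e, t)) = opSetoid j k := by
  have hmono : ∀ k, H.freeSetoid ≤ H.base k → (∀ j, opSetoid j 0 ≤ opSetoid j k) →
      smooth (H.base 0) (fun t : {g // g ≠ e} × Bool × Bool => H.arrow (t.1, t.2))
        (fun g => opSetoid (τ g) 0) ≤
      smooth (H.base k) (fun t : {g // g ≠ e} × Bool × Bool => H.arrow (t.1, t.2))
        fun g => opSetoid (τ g) k := by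
    intro k hk hj
    obtain ⟨h1, h2⟩ := smooth_le_iff.1 (le_refl (smooth (H.base k)
      (fun t : {g // g ≠ e} × Bool × Bool => H.arrow (t.1, t.2)) fun g => opSetoid (τ g) k))
    exact smooth_le_iff.2 ⟨hk.trans h1, fun g => (hj _).trans (h2 g)⟩
  refine exists_eq_opSetoid _ (H.comap_smooth_freeSetoid e τ)
    (comap_mono (hmono 1 (H.freeSetoid_le_vertexSetoid.trans H.vertex_le) opSetoid_zero_le_one))
    (comap_mono (hmono 2 (H.freeSetoid_le_boundarySetoid.trans H.boundary_le)
      opSetoid_zero_le_two)) ?_ ?_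
  · exact (H.ker_fst_le_vertexPartition e).trans (comap_mono (le_smooth _ _ _))
  · exact (H.ker_xor_le_boundaryPartition e).trans (comap_mono (le_smooth _ _ _))

theorem base_twoSum (G H : PackagedArrowPresentation.{u}) (f : G.Edge) (e : H.Edge)
    (φ : Coupling) : ((G.twoSum H f e φ).base : Fin 3 → Setoid (G.Pt ⊕ H.Pt)) = fun k =>
      glueAlong (fun t => G.arrow (f, Prod.map φ.symm id t)) (fun t => H.arrow (e, t))
        (G.base k) (H.base k) := by
  funext k
  fin_cases k
  · exact (freeSetoid_twoSum _ _ _ _ _).trans (glue_eq_glueAlong _ _ _ _ _ _ _)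
  · exact glue_eq_glueAlong _ _ _ _ _ _ _
  · exact glue_eq_glueAlong _ _ _ _ _ _ _

/-- A 2-sum with `H` along `e` amounts to a change of the weights of the edge of the other summand,
and the new weights solve the linear system. -/
theorem exists_weight (x : Fin 3 → K) (v : Fin 5 → K) (H : PackagedArrowPresentation.{u})
    (e : H.Edge) : ∃ ϕ : Fin 5 → K,
      (Matrix.of (pairing x)).mulVec ϕ =
        ![stateSum x (H.delete e) fun _ => v, stateSum x (H.contract e) fun _ => v,
          stateSum x (H.penrose e) fun _ => v, stateSum x (H.mergeDelete e) fun _ => v,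
          stateSum x (H.mergeContract e) fun _ => v] ∧
      ∀ (G : PackagedArrowPresentation.{u}) (f : G.Edge) (c : Coupling) (w : G.Edge → Fin 5 → K),
        w f = ϕ → stateSum x (G.twoSum H f e c) (Sum.elim (fun g => w g.1) fun _ => v) =
          stateSum x G w := by
  classical
  let := Fintype.ofFinite {g : H.Edge // g ≠ e}
  -- The types, and hence the weights, are chosen from `H` and `e` alone, so one `ϕ` serves all `G`,
  -- `f` and couplings.
  choose typ htyp using H.exists_type e
  refine ⟨transferWeight x (fun _ => v) H.base
    (fun t : {g // g ≠ e} × Bool × Bool => H.arrow (t.1, t.2)) (fun t => H.arrow (e, t)) typ, ?_, fun G f c w hw => ?_⟩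
  · have h := stateSum_sup_map x (fun _ => v) H.base
      (fun t : {g // g ≠ e} × Bool × Bool => H.arrow (t.1, t.2)) (fun t => H.arrow (e, t)) typ htyp
    funext i
    refine (h i).symm.trans ?_
    fin_cases i
    · exact (stateSum_delete x H e _).symm
    · exact (stateSum_contract x H e _).symm
    · exact (stateSum_penrose x H e _).symm
    · exact (stateSum_mergeDelete x H e _).symm
    · exact (stateSum_mergeContract x H e _).symm
  · have h := stateSum_glueAlong x (fun g : {g // g ≠ f} => w g) (fun _ => v) G.base H.base
      (fun t => G.arrow (t.1, t.2))
      (fun t : {g // g ≠ e} × Bool × Bool => H.arrow (t.1, t.2)) (fun t => G.arrow (f, Prod.map c.symm id t))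
      (fun t => H.arrow (e, t)) typ htyp
    rw [← base_twoSum] at h
    refine h.trans ?_
    refine Eq.trans ?_ (stateSum_split x w G.base G.arrow f).symm
    simp only [hw, map_opSetoid_coupling (fun t => G.arrow (f, t))]

/-- Edges still to be replaced carry the weights `ϕ`, all others carry `v`. A 2-sum trades one edge
of weight `ϕ` for edges of `H` of weight `v` without changing the state sum, so the order of the
2-sums is immaterial. -/
theorem stateSum_iteratedTwoSum (x : Fin 3 → K) (v ϕ : Fin 5 → K)
    (H : PackagedArrowPresentation.{u}) (e : H.Edge)
    (h : ∀ (G : PackagedArrowPresentation.{u}) (f : G.Edge) (c : Coupling)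
      (w : G.Edge → Fin 5 → K), w f = ϕ →
        stateSum x (G.twoSum H f e c) (Sum.elim (fun g => w g.1) fun _ => v) = stateSum x G w)
    {P R : PackagedArrowPresentation.{u}} {φ : P.Edge → Option Coupling}
    (hR : IteratedTwoSum H e P φ R) :
    stateSum x R (fun _ => v) = stateSum x P fun g => (φ g).elim v fun _ => ϕ := by
  induction hR with
  | done P φ hφ => simp only [hφ, Option.elim_none]
  | step P φ R f c hf _ ih =>
    rw [ih, ← h P f c _ (by rw [hf, Option.elim_some])]
    congr 1
    funext g
    rcases g with g | g <;> rfl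

end PackagedArrowPresentation

/-! ### The linear system and the main theorem. -/

theorem isZPolynomial_iff {Z : PackagedArrowPresentation.{u} → MvPolynomial ZVar ℤ} :
    IsZPolynomial Z ↔ PackagedArrowPresentation.IsFiveTerm ![.X .α, .X .β, .X .γ]
      ![.X .a, .X .b, 0, 0, 0] Z := by
  simp [IsZPolynomial, PackagedArrowPresentation.IsFiveTerm]

theorem isQPolynomial_iff {Q : PackagedArrowPresentation.{u} → MvPolynomial QVar ℤ} :
    IsQPolynomial Q ↔ PackagedArrowPresentation.IsFiveTerm ![.X .α, .X .β, .X .γ]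
      ![.X .a, .X .b, .X .c, .X .x, .X .y] Q := by
  simp [IsQPolynomial, PackagedArrowPresentation.IsFiveTerm]

theorem tensorMatrix_eq_pairing : tensorMatrix =
    Matrix.of (ArrowPresentation.pairing ![zVar .α, zVar .β, zVar .γ]) := by
  ext i j
  exact (ArrowPresentation.pairing_eq ![zVar .α, zVar .β, zVar .γ] i j).symm

theorem toZField_ne_zero {p : MvPolynomial ZVar ℤ} (t : ZVar → ℤ)
    (h : MvPolynomial.eval t p ≠ 0) : toZField p ≠ 0 := by
  intro h0
  rw [toZField, IsFractionRing.to_map_eq_zero_iff] at h0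
  exact h (by rw [h0, map_zero])

/-- Apart from the power of `αβγ` split off first, only the factors `α`, `α - 1`, `α + 2`, `β - 1`
and `γ - 1` need to be nonzero; each is nonzero at an integer point. With them a null vector is
eliminated coordinate by coordinate. -/
theorem det_tensorMatrix_ne_zero : tensorMatrix.det ≠ 0 := by
  have hα : zVar .α ≠ 0 := toZField_ne_zero (fun _ => 1) (by simp)
  have hβ : zVar .β ≠ 0 := toZField_ne_zero (fun _ => 1) (by simp)
  have hγ : zVar .γ ≠ 0 := toZField_ne_zero (fun _ => 1) (by simp)
  have hα1 : zVar .α - 1 ≠ 0 := by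
    simpa using toZField_ne_zero (p := .X .α - 1) (fun _ => 0) (by simp)
  have hβ1 : zVar .β - 1 ≠ 0 := by
    simpa using toZField_ne_zero (p := .X .β - 1) (fun _ => 0) (by simp)
  have hγ1 : zVar .γ - 1 ≠ 0 := by
    simpa using toZField_ne_zero (p := .X .γ - 1) (fun _ => 0) (by simp)
  have hα2 : zVar .α + 2 ≠ 0 := by
    have h := toZField_ne_zero (p := .X .α + 2) (fun _ => 1) (by norm_num [map_ofNat])
    rwa [toZField, map_add, map_ofNat] at h
  rw [tensorMatrix, Matrix.det_smul]
  refine mul_ne_zero (pow_ne_zero _ (mul_ne_zero (mul_ne_zero hα hβ) hγ)) ?_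
  generalize zVar .α = α at *
  generalize zVar .β = β at *
  generalize zVar .γ = γ at *
  rw [Ne, ← Matrix.exists_mulVec_eq_zero_iff]
  rintro ⟨v, hv, h⟩
  have h0 := congrFun h 0
  have h1 := congrFun h 1
  have h2 := congrFun h 2
  have h3 := congrFun h 3
  have h4 := congrFun h 4
  simp [Matrix.mulVec, dotProduct, Fin.sum_univ_five] at h0 h1 h2 h3 h4
  -- Rows `0` and `3` differ only in their first entry, and rows `1` and `4` only in their second.
  have v0 : v 0 = 0 := by
    have : α * (β - 1) * v 0 = 0 := by linear_combination h0 - h3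
    simpa [hα, hβ1] using this
  have v1 : v 1 = 0 := by
    have : α * (γ - 1) * v 1 = 0 := by linear_combination h1 - h4
    simpa [hα, hγ1] using this
  -- What remains is the 3 by 3 matrix with `α` on the diagonal and `1` elsewhere. Up to the factor
  -- `(α - 1) * (α + 2)`, its inverse has `α + 1` on the diagonal and `-1` elsewhere, whence the
  -- coefficients below.
  rw [v0, v1] at h2 h3 h4
  have v2 : v 2 = 0 := by
    have : (α - 1) * (α + 2) * v 2 = 0 := by linear_combination (α + 1) * h2 - h3 - h4
    simpa [hα1, hα2] using this
  have v3 : v 3 = 0 := by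
    have : (α - 1) * (α + 2) * v 3 = 0 := by linear_combination (α + 1) * h3 - h2 - h4
    simpa [hα1, hα2] using this
  have v4 : v 4 = 0 := by
    have : (α - 1) * (α + 2) * v 4 = 0 := by linear_combination (α + 1) * h4 - h2 - h3
    simpa [hα1, hα2] using this
  refine hv (funext fun i => ?_)
  fin_cases i <;> assumption

/-- The polynomials `Z` and `Q` are well defined by their recursions, the linear system has a unique
solution, and at this solution `Q G` takes the value `Z` of the tensor product. -/
theorem mainTheorem4 :
    (∃! Z : PackagedArrowPresentation.{u} → MvPolynomial ZVar ℤ, IsZPolynomial Z) ∧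
    (∃! Q : PackagedArrowPresentation.{u} → MvPolynomial QVar ℤ, IsQPolynomial Q) ∧
    ∀ (Z : PackagedArrowPresentation.{u} → MvPolynomial ZVar ℤ)
      (Q : PackagedArrowPresentation.{u} → MvPolynomial QVar ℤ),
      IsZPolynomial Z → IsQPolynomial Q →
      ∀ (G H : PackagedArrowPresentation.{u}) (e : H.Edge)
        (φ : G.Edge → ArrowPresentation.Coupling) (T : PackagedArrowPresentation.{u}),
        PackagedArrowPresentation.IsTensorProduct G H e φ T →
        ∃ ϕ : Fin 5 → ZField,
          tensorMatrix.mulVec ϕ = tensorVector Z H e ∧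
          (∀ ψ : Fin 5 → ZField, tensorMatrix.mulVec ψ = tensorVector Z H e → ψ = ϕ) ∧
          toZField (Z T) = evalQ ϕ (Q G) := by
  refine ⟨⟨_, isZPolynomial_iff.2 (PackagedArrowPresentation.isFiveTerm_stateSum _ _),
      fun Z hZ => (isZPolynomial_iff.1 hZ).unique
        (PackagedArrowPresentation.isFiveTerm_stateSum _ _)⟩,
    ⟨_, isQPolynomial_iff.2 (PackagedArrowPresentation.isFiveTerm_stateSum _ _),
      fun Q hQ => (isQPolynomial_iff.1 hQ).unique
        (PackagedArrowPresentation.isFiveTerm_stateSum _ _)⟩, ?_⟩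
  intro Z Q hZ hQ G H e φ T hT
  have hZ' := (isZPolynomial_iff.1 hZ).map (algebraMap (MvPolynomial ZVar ℤ) ZField)
  set x : Fin 3 → ZField := fun k => algebraMap (MvPolynomial ZVar ℤ) ZField
    ((![.X .α, .X .β, .X .γ] : Fin 3 → MvPolynomial ZVar ℤ) k) with hx
  set v : Fin 5 → ZField := fun j => algebraMap (MvPolynomial ZVar ℤ) ZField
    ((![.X .a, .X .b, 0, 0, 0] : Fin 5 → MvPolynomial ZVar ℤ) j)
  have hx' : x = ![zVar .α, zVar .β, zVar .γ] := by
    funext k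
    fin_cases k <;> rfl
  obtain ⟨ϕ, hϕ, hsum⟩ := PackagedArrowPresentation.exists_weight x v H e
  have hsys : tensorMatrix.mulVec ϕ = tensorVector Z H e := by
    rw [tensorMatrix_eq_pairing, ← hx', hϕ, tensorVector]
    simp only [← hZ'.eq_stateSum]
  refine ⟨ϕ, hsys, fun ψ hψ => ?_, ?_⟩
  · exact Matrix.mulVec_injective_of_isUnit
      ((Matrix.isUnit_iff_isUnit_det _).2 det_tensorMatrix_ne_zero.isUnit) (hψ.trans hsys.symm)
  · have hQ' := (isQPolynomial_iff.1 hQ).map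
      (MvPolynomial.aeval (R := ℤ) (S₁ := ZField) (fun
        | QVar.a => ϕ 0
        | QVar.b => ϕ 1
        | QVar.c => ϕ 2
        | QVar.x => ϕ 3
        | QVar.y => ϕ 4
        | QVar.α => zVar .α
        | QVar.β => zVar .β
        | QVar.γ => zVar .γ)).toRingHom
    refine (hZ'.eq_stateSum T).trans (Eq.trans ?_ (hQ'.eq_stateSum G).symm)
    -- Every edge of `G` has a coupling, so after this step all of them carry `ϕ`. Both sides are
    -- then state sums of `G`, and only variables and weights have to be compared.
    rw [PackagedArrowPresentation.stateSum_iteratedTwoSum x v ϕ H e hsum hT]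
    congr 1
    · funext k
      rw [hx']
      fin_cases k <;> simp
    · funext g j
      fin_cases j <;> simp
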